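/- Let $M\ge 1$, $K\ge 1$ and $g_{mk}\in\mathbb{C}$ for $1\le m\le M$, $1\le k\le K$; put $\mathsf{SNR}_{mk}=|g_{mk}|^2$. In the $M$-transmitter $K$-receiver Gaussian multicast channel with feedback, receiver $k$ receives at time $i$ the signal $Y_{ki}=\sum_{m=1}^M g_{mk}X_{mi}+Z_{ki}$, where the noises $Z_{ki}\sim\mathcal{CN}(0,1)$ are independent over $k$ and $i$ and independent of the messages. For block length $N$ and rates $R_m\ge 0$, transmitter $m$ has a message $W_m$ uniformly distributed on $\{1,\dots,\lfloor 2^{NR_m}\rfloor\}$, the messages being independent; it sends $X_{mi}=f_{mi}(W_m,Y_1^{i-1},\dots,Y_K^{i-1})$ with measurable $f_{mi}$, subject to the power constraint $\frac1N\sum_{i=1}^N E|X_{mi}|^2\le 1$; and each receiver $k$ estimates all messages $(W_1,\dots,W_M)$ as a measurable function of $Y_k^N$. A rate tuple $(R_1,\dots,R_M)$ is achievable if for all $N$ there are such codes for which the average probability of error of every receiver tends to $0$ as $N\to\infty$; the feedback capacity region $\mathcal{C}_M$ is the closure in $\mathbb{R}^M$ of the set of achievable rate tuples. Then for every $(R_1,\dots,R_M)\in\mathcal{C}_M$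 all $R_m$ are nonnegative, and there is a positive semidefinite Hermitian $M\times M$ matrix $K_X$ with $[K_X]_{mm}=1$ for all $m$ (the covariance matrix of an input vector $X$ of unit powers) such that, with this one $K_X$ and $\rho_{mn}:=|[K_X]_{mn}|$, $$\sum_{m\in\mathcal S}R_m\le\log_2\left|I_K+G_{\mathcal S}K_{\mathcal S|\mathcal S^c}G_{\mathcal S}^*\right|\qquad\text{for every }\mathcal S\subsetneq\{1,\dots,M\},$$ $$\sum_{m=1}^M R_m\le\log_2\left(1+\sum_{m=1}^M\mathsf{SNR}_{mk}+\sum_{m\ne n}\rho_{mn}\sqrt{\mathsf{SNR}_{mk}\,\mathsf{SNR}_{nk}}\right)\qquad\text{for every }k\in\{1,\dots,K\}.$$ Here $|\cdot|$ of a matrix is its determinant, $G_{\mathcal S}$ is the $K\times|\mathcal S|$ matrix with entries $[G_{\mathcal S}]_{km}=g_{mk}$, $m\in\mathcal S$; $K_{\mathcal S|\mathcal S^c}=[K_X]_{\mathcal S,\mathcal S}-[K_X]_{\mathcal S,\mathcal S^c}\,[K_X]_{\mathcal S^c,\mathcal S^c}^{+}\,[K_X]_{\mathcal S^c,\mathcal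 S}$ is the conditional covariance matrix of $X_{\mathcal S}$ given $X_{\mathcal S^c}$ (for Gaussian $X$ with covariance $K_X$; ${}^{+}$ is the Moore–Penrose inverse), and the sum over $m\neq n$ runs over ordered pairs. -/

import Mathlib

open MeasureTheory ProbabilityTheory Filter Topology
open scoped ComplexOrder ENNReal

noncomputable section

namespace GaussianMulticast

/-- The circularly symmetric complex Gaussian law `CN(0, 1)`: real and imaginary parts are
independent real Gaussians of mean `0` and variance `1/2`. -/
def stdComplexGaussian : Measure ℂ :=
  ((gaussianReal 0 (1 / 2)).prod (gaussianReal 0 (1 / 2))).map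
    (fun p : ℝ × ℝ => (⟨p.1, p.2⟩ : ℂ))

/-- A feedback code of block length `N` for `M` transmitters and `K` receivers; transmitter `m`
has `L m` messages. At time `i` (times are `0, …, N - 1`) transmitter `m` sends a function of its
own message and of everything all receivers have received at the times `t < i`; after time `N - 1`
receiver `k` estimates all messages from its own received block. -/
structure FeedbackCode (M K N : ℕ) (L : Fin M → ℕ) where
  /-- encoding function of transmitter `m` at time `i` -/
  enc : (m : Fin M) → (i : Fin N) → Fin (L m) → (Fin i → Fin K → ℂ) → ℂ
  measurable_enc : ∀ m i w, Measurable (enc m i w)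
  /-- decoding function of receiver `k` -/
  dec : (k : Fin K) → (Fin N → ℂ) → ((m : Fin M) → Fin (L m))
  measurable_dec : ∀ k, Measurable (dec k)

/-- The signals received at time `i` by all receivers when the messages are `w` and the noise is
`z`: `Y_{k i} = ∑ m, g_{m k} X_{m i} + Z_{k i}`, where `X_{m i}` is computed from the message
`w m` and the signals received at the times `t < i`. -/
def FeedbackCode.output {M K N : ℕ} {L : Fin M → ℕ} (c : FeedbackCode M K N L)
    (g : Fin M → Fin K → ℂ) (w : (m : Fin M) → Fin (L m)) (z : Fin N → Fin K → ℂ)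
    (i : Fin N) : Fin K → ℂ :=
  fun k => (∑ m, g m k * c.enc m i (w m)
    (fun t => c.output g w z ⟨t.1, t.2.trans i.2⟩)) + z i k
termination_by i.1
decreasing_by exact t.2

/-- The signal `X_{m i}` sent by transmitter `m` at time `i`. -/
def FeedbackCode.input {M K N : ℕ} {L : Fin M → ℕ} (c : FeedbackCode M K N L)
    (g : Fin M → Fin K → ℂ) (w : (m : Fin M) → Fin (L m)) (z : Fin N → Fin K → ℂ)
    (m : Fin M) (i : Fin N) : ℂ :=
  c.enc m i (w m) (fun t => c.output g w z ⟨t.1, t.2.trans i.2⟩)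

/-- The joint law of messages and noise: the messages are independent and uniform, the noises
`Z_{k i}` are independent with law `CN(0, 1)` and independent of the messages. -/
def jointLaw (K N : ℕ) {M : ℕ} (L : Fin M → ℕ) :
    Measure (((m : Fin M) → Fin (L m)) × (Fin N → Fin K → ℂ)) :=
  (Measure.pi fun m => uniformOn (Set.univ : Set (Fin (L m)))).prod
    (Measure.pi fun _ : Fin N => Measure.pi fun _ : Fin K => stdComplexGaussian)

/-- Unit average transmit power: `(1/N) ∑ i, E |X_{m i}|² ≤ 1` for every transmitter `m`. -/
def FeedbackCode.PowerConstraint {M K N : ℕ} {L : Fin M → ℕ} (c : FeedbackCode M K N L)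
    (g : Fin M → Fin K → ℂ) : Prop :=
  ∀ m, ∑ i : Fin N, ∫⁻ p, ‖c.input g p.1 p.2 m i‖ₑ ^ 2 ∂(jointLaw K N L) ≤ (N : ℝ≥0∞)

/-- The average probability that receiver `k` does not recover all messages. -/
def FeedbackCode.errorProb {M K N : ℕ} {L : Fin M → ℕ} (c : FeedbackCode M K N L)
    (g : Fin M → Fin K → ℂ) (k : Fin K) : ℝ≥0∞ :=
  jointLaw K N L {p | c.dec k (fun i => c.output g p.1 p.2 i k) ≠ p.1}

/-- The number `⌊2 ^ (N R)⌋` of messages at rate `R` (bits per channel use), block length `N`. -/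
def numMessages (N : ℕ) (R : ℝ) : ℕ := ⌊(2 : ℝ) ^ ((N : ℝ) * R)⌋₊

/-- A tuple of nonnegative rates is achievable if there are codes of all block lengths `N`, with
`⌊2 ^ (N R_m)⌋` messages at transmitter `m` and satisfying the power constraints, for which the
average error probability at every receiver tends to zero as `N → ∞`. -/
def Achievable {M K : ℕ} (g : Fin M → Fin K → ℂ) (R : Fin M → ℝ) : Prop :=
  (∀ m, 0 ≤ R m) ∧
    ∃ c : (N : ℕ) → FeedbackCode M K N (fun m => numMessages N (R m)),
      (∀ N, (c N).PowerConstraint g) ∧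
        ∀ k, Tendsto (fun N => (c N).errorProb g k) atTop (𝓝 0)

/-- The feedback capacity region: the closure of the set of achievable rate tuples. -/
def capacityRegion {M K : ℕ} (g : Fin M → Fin K → ℂ) : Set (Fin M → ℝ) :=
  closure {R | Achievable g R}

/-- The signal-to-noise ratio `|g_{m k}|²`. -/
def snr {M K : ℕ} (g : Fin M → Fin K → ℂ) (m : Fin M) (k : Fin K) : ℝ := ‖g m k‖ ^ 2

/-- The `K × |S|` matrix `G_S` in `Y = G_S X_S + G_{Sᶜ} X_{Sᶜ} + Z`. -/
def gainMatrix {M K : ℕ} (g : Fin M → Fin K → ℂ) (S : Finset (Fin M)) :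
    Matrix (Fin K) {m // m ∈ S} ℂ :=
  Matrix.of fun k m => g m.1 k

/-- The Moore–Penrose inverse of a Hermitian matrix: each eigenvalue `x` is replaced by `x⁻¹`,
where `0⁻¹ = 0`. -/
def pinv {n : Type*} [Fintype n] [DecidableEq n] (A : Matrix n n ℂ) : Matrix n n ℂ :=
  cfc (fun x : ℝ => x⁻¹) A

/-- The conditional covariance matrix of `X_S` given `X_{Sᶜ}`, for a (Gaussian) vector `X` with
covariance matrix `Q`: `Q_{S,S} - Q_{S,Sᶜ} (Q_{Sᶜ,Sᶜ})⁺ Q_{Sᶜ,S}`. -/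
def condCov {M : ℕ} (Q : Matrix (Fin M) (Fin M) ℂ) (S : Finset (Fin M)) :
    Matrix {m // m ∈ S} {m // m ∈ S} ℂ :=
  Q.toBlock (· ∈ S) (· ∈ S) -
    Q.toBlock (· ∈ S) (· ∉ S) * pinv (Q.toBlock (· ∉ S) (· ∉ S)) * Q.toBlock (· ∉ S) (· ∈ S)

/-- The rate tuples that satisfy, for one and the same input covariance matrix `Q` of unit
powers, the bounds for all proper subsets `S` of transmitters and the sum-rate bounds at all
receivers. The determinant is that of a Hermitian matrix, so it is real; logarithms are to
base `2`; the sum over `m ≠ n` runs over ordered pairs. -/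
def outerBoundRegion {M K : ℕ} (g : Fin M → Fin K → ℂ) : Set (Fin M → ℝ) :=
  {R | (∀ m, 0 ≤ R m) ∧
    ∃ Q : Matrix (Fin M) (Fin M) ℂ, Q.PosSemidef ∧ (∀ m, Q m m = 1) ∧
      (∀ S : Finset (Fin M), S ≠ Finset.univ →
        ∑ m ∈ S, R m ≤
          Real.logb 2
            (1 + gainMatrix g S * condCov Q S * (gainMatrix g S).conjTranspose).det.re) ∧
      (∀ k : Fin K,
        ∑ m, R m ≤
          Real.logb 2
            (1 + ∑ m, snr g m k +
              ∑ m, ∑ n ∈ Finset.univ.erase m, ‖Q m n‖ * √(snr g m k * snr g n k)))}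

end GaussianMulticast

end

noncomputable section

namespace GaussianMulticast

/-! The bounds are proved by a change of measure instead of entropy inequalities. Write `G` for the
matrix of all gains. Given a matrix `B`, compare the true channel `Y = G X + Z` with an auxiliary
Gaussian channel that has gains `G - B`, the same encoders and feedback, and noise covariance `1 + B
Q Bᴴ`. If the columns of `B` in `S` are those of `G`, the auxiliary outputs carry no information
about the messages in `S`, so a decoder succeeds there with probability at most `1 / ∏ m ∈ S, L m`
(`setLIntegral_exp_neg_logRatio_le`). Under the true channel, the log-likelihood ratio has mean at
most `N log det (1 + B Q Bᴴ)` as soon as `Q` dominates the time-averaged second moments of the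
inputs (`integral_logRatio_le`). The two facts combine in `measureReal_mul_log_le` to the weak
converse `log_card_messages_le`.

One `Q` serves all cuts: the averaged input moment matrix, its diagonal filled up to `1`
(`exists_unit_power_covariance`). For the bound at `S`, take `B = G_S C`, where `C X` is the error
of the linear estimate of `X_S` from the other inputs; then `B Q Bᴴ` is the conditional covariance
term (`exists_gain_mul_condCov_eq`). For the sum rate at receiver `k`, keep only row `k` of `G` in
`B`: receiver `k` then sees pure noise.

A compactness argument passes to the limit of long blocks and to the closure. As the pseudoinverse
is discontinuous in `Q`, the bounds are carried to the limit for every admissible `B` at once, and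
`B` is chosen only for the limiting `Q`. -/

/-! ### Gaussian noise: density, symmetry, linear change of variables. -/

lemma stdComplexGaussian_eq_withDensity :
    stdComplexGaussian =
      (volume : Measure ℂ).withDensity
        (fun z => ENNReal.ofReal (Real.pi⁻¹ * Real.exp (-‖z‖ ^ 2))) := by
  have hv : (1 / 2 : NNReal) ≠ 0 := by norm_num
  have hm : (fun p : ℝ × ℝ => (⟨p.1, p.2⟩ : ℂ)) = Complex.measurableEquivRealProd.symm := rfl
  rw [stdComplexGaussian, gaussianReal_of_var_ne_zero _ hv,
    prod_withDensity (measurable_gaussianPDF _ _) (measurable_gaussianPDF _ _), hm]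
  ext s hs
  rw [MeasurableEquiv.map_apply, withDensity_apply _ (MeasurableEquiv.measurable _ hs),
    withDensity_apply _ hs,
    ← Complex.volume_preserving_equiv_real_prod.symm.setLIntegral_comp_preimage_emb
      (MeasurableEquiv.measurableEmbedding _)]
  rw [← Measure.volume_eq_prod]
  refine lintegral_congr fun p => ?_
  rw [gaussianPDF, gaussianPDF, ← ENNReal.ofReal_mul (gaussianPDFReal_nonneg _ _ _)]
  congr 1
  simp only [gaussianPDFReal, Complex.sq_norm, Complex.normSq_apply,
    Complex.measurableEquivRealProd_symm_apply, sub_zero]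
  have h : (√(2 * Real.pi * ((1 / 2 : NNReal) : ℝ)))⁻¹ * (√(2 * Real.pi * ((1 / 2 : NNReal) : ℝ)))⁻¹
      = Real.pi⁻¹ := by
    rw [← mul_inv, Real.mul_self_sqrt (by positivity)]
    congr 1
    push_cast
    ring
  rw [mul_mul_mul_comm, h, ← Real.exp_add]
  congr 2
  push_cast
  ring

instance : IsProbabilityMeasure stdComplexGaussian := by
  unfold stdComplexGaussian
  exact Measure.isProbabilityMeasure_map
    (Complex.measurableEquivRealProd.symm.measurable.aemeasurable)

lemma integrable_exp_neg_sq_norm :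
    Integrable (fun z : ℂ => Real.pi⁻¹ * Real.exp (-‖z‖ ^ 2)) := by
  refine ⟨by fun_prop, ?_⟩
  rw [hasFiniteIntegral_iff_ofReal (ae_of_all _ fun _ => by positivity)]
  have h : stdComplexGaussian Set.univ = 1 := measure_univ
  rw [stdComplexGaussian_eq_withDensity, withDensity_apply _ MeasurableSet.univ,
    setLIntegral_univ] at h
  simp [h]

lemma measurePreserving_neg_stdComplexGaussian :
    MeasurePreserving (fun z : ℂ => -z) stdComplexGaussian stdComplexGaussian := by
  refine ⟨measurable_neg, ?_⟩
  have hm : Measurable (fun p : ℝ × ℝ => (⟨p.1, p.2⟩ : ℂ)) :=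
    Complex.measurableEquivRealProd.symm.measurable
  have hg : MeasurePreserving (fun x : ℝ => -x) (gaussianReal 0 (1 / 2)) (gaussianReal 0 (1 / 2)) :=
    ⟨measurable_neg, by rw [gaussianReal_map_neg, neg_zero]⟩
  rw [stdComplexGaussian, Measure.map_map measurable_neg hm]
  conv_rhs => rw [← (hg.prod hg).map_eq, Measure.map_map hm (hg.prod hg).measurable]
  congr 1

lemma lintegral_sq_enorm_stdComplexGaussian :
    ∫⁻ z, ‖z‖ₑ ^ 2 ∂stdComplexGaussian = 1 := by
  have hm : Measurable (fun p : ℝ × ℝ => (⟨p.1, p.2⟩ : ℂ)) :=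
    Complex.measurableEquivRealProd.symm.measurable
  have hr : ∫⁻ x, ENNReal.ofReal (x ^ 2) ∂(gaussianReal 0 (1 / 2)) = ENNReal.ofReal (1 / 2) := by
    have h := variance_id_gaussianReal (μ := 0) (v := 1 / 2)
    rw [variance_of_integral_eq_zero (by fun_prop) (by simp)] at h
    simp only [id_eq] at h
    rw [← ofReal_integral_eq_lintegral_ofReal]
    · rw [h]; push_cast; rfl
    · exact (memLp_id_gaussianReal 2).integrable_sq
    · exact ae_of_all _ fun x => sq_nonneg x
  rw [stdComplexGaussian, lintegral_map (by fun_prop) hm]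
  have h : ∀ p : ℝ × ℝ, ‖(⟨p.1, p.2⟩ : ℂ)‖ₑ ^ 2 =
      ENNReal.ofReal (p.1 ^ 2) + ENNReal.ofReal (p.2 ^ 2) := fun p => by
    rw [← ENNReal.ofReal_add (sq_nonneg _) (sq_nonneg _), ← ofReal_norm,
      ← ENNReal.ofReal_pow (norm_nonneg _), Complex.sq_norm, Complex.normSq_apply]
    ring_nf
  simp_rw [h]
  rw [lintegral_add_left (by fun_prop),
    lintegral_prod _ (by fun_prop), lintegral_prod _ (by fun_prop)]
  simp only [lintegral_const, measure_univ, mul_one]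
  rw [hr, ← ENNReal.ofReal_add (by norm_num) (by norm_num)]
  norm_num

/-- The law of `K` independent standard complex Gaussians. -/
abbrev noiseLaw (K : ℕ) : Measure (Fin K → ℂ) := Measure.pi fun _ => stdComplexGaussian

lemma noiseLaw_eq_withDensity (K : ℕ) :
    noiseLaw K = (volume : Measure (Fin K → ℂ)).withDensity
      (fun z => ENNReal.ofReal (∏ k, (Real.pi⁻¹ * Real.exp (-‖z k‖ ^ 2)))) := by
  refine Measure.pi_eq fun s hs => ?_
  rw [withDensity_apply _ (MeasurableSet.univ_pi hs)]
  have hbox : ∀ z : Fin K → ℂ, (Set.univ.pi s).indicator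
      (fun z : Fin K → ℂ => ∏ k, (Real.pi⁻¹ * Real.exp (-‖z k‖ ^ 2))) z =
        ∏ k, (s k).indicator (fun z => Real.pi⁻¹ * Real.exp (-‖z‖ ^ 2)) (z k) := fun z => by
    classical
    by_cases hz : z ∈ Set.univ.pi s
    · rw [Set.indicator_of_mem hz]
      exact Finset.prod_congr rfl fun k _ => (Set.indicator_of_mem (hz k trivial)
        (fun z => Real.pi⁻¹ * Real.exp (-‖z‖ ^ 2))).symm
    · rw [Set.indicator_of_notMem hz]
      simp only [Set.mem_pi, Set.mem_univ, true_implies, not_forall] at hz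
      obtain ⟨k, hk⟩ := hz
      exact (Finset.prod_eq_zero (Finset.mem_univ k) (Set.indicator_of_notMem hk _)).symm
  rw [← ofReal_integral_eq_lintegral_ofReal, ← integral_indicator (MeasurableSet.univ_pi hs)]
  · simp_rw [hbox]
    rw [integral_fintype_prod_volume_eq_prod
      (f := fun k => (s k).indicator (fun z => Real.pi⁻¹ * Real.exp (-‖z‖ ^ 2))),
      ENNReal.ofReal_prod_of_nonneg]
    · refine Finset.prod_congr rfl fun k _ => ?_
      rw [integral_indicator (hs k), stdComplexGaussian_eq_withDensity,
        withDensity_apply _ (hs k), ofReal_integral_eq_lintegral_ofReal]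
      · exact integrable_exp_neg_sq_norm.integrableOn
      · exact ae_of_all _ fun _ => by positivity
    · intro k _
      exact integral_nonneg fun z => Set.indicator_nonneg (fun _ _ => by positivity) _
  · exact (Integrable.fintype_prod (f := fun _ : Fin K => fun z : ℂ => Real.pi⁻¹ * Real.exp (-‖z‖ ^ 2))
      fun _ => integrable_exp_neg_sq_norm).integrableOn
  · exact ae_of_all _ fun _ => Finset.prod_nonneg fun _ _ => by positivity

/-- The squared Euclidean length. -/
def sqLength {K : ℕ} (v : Fin K → ℂ) : ℝ := ∑ k, ‖v k‖ ^ 2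

@[fun_prop]
lemma measurable_sqLength {K : ℕ} : Measurable (sqLength (K := K)) := by
  unfold sqLength
  fun_prop

lemma lintegral_noiseLaw {K : ℕ} {f : (Fin K → ℂ) → ℝ≥0∞} (hf : Measurable f) :
    ∫⁻ z, f z ∂noiseLaw K =
      ∫⁻ z, ENNReal.ofReal (Real.pi⁻¹ ^ K * Real.exp (-sqLength z)) * f z := by
  have h : ∀ z : Fin K → ℂ, ∏ k, (Real.pi⁻¹ * Real.exp (-‖z k‖ ^ 2)) =
      Real.pi⁻¹ ^ K * Real.exp (-sqLength z) := fun z => by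
    rw [Finset.prod_mul_distrib, ← Real.exp_sum, sqLength]
    simp
  rw [noiseLaw_eq_withDensity, lintegral_withDensity_eq_lintegral_mul _ _ hf]
  · simp_rw [h, Pi.mul_apply]
  · simp_rw [h]
    fun_prop

/-- The real determinant of a complex-linear map is the squared modulus of its complex determinant.
-/
lemma lintegral_comp_mulVec {K : ℕ} {L : Matrix (Fin K) (Fin K) ℂ} (hL : L.det ≠ 0)
    {f : (Fin K → ℂ) → ℝ≥0∞} (hf : Measurable f) :
    ∫⁻ z, f (L.mulVec z) = ENNReal.ofReal ((‖L.det‖ ^ 2)⁻¹) * ∫⁻ z, f z := by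
  have hdet : LinearMap.det (L.toLin'.restrictScalars ℝ) = ‖L.det‖ ^ 2 := by
    rw [LinearMap.det_restrictScalars, LinearMap.det_toLin', Complex.sq_norm,
      Algebra.norm_complex_apply]
  have h0 : LinearMap.det (L.toLin'.restrictScalars ℝ) ≠ 0 := by
    rw [hdet]
    positivity
  have h := Measure.map_linearMap_addHaar_eq_smul_addHaar (volume : Measure (Fin K → ℂ)) h0
  have hm : Measurable (L.toLin'.restrictScalars ℝ : (Fin K → ℂ) → (Fin K → ℂ)) :=
    (LinearMap.continuous_of_finiteDimensional (L.toLin'.restrictScalars ℝ)).measurable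
  have h2 := lintegral_map (μ := volume) hf hm
  rw [h, lintegral_smul_measure, hdet] at h2
  rw [abs_of_nonneg (by positivity)] at h2
  simpa using h2.symm

/-- Change of measure from the standard Gaussian law translated by `d` to the centred Gaussian law
with covariance matrix `L Lᴴ`. -/
lemma lintegral_noiseLaw_change {K : ℕ} {L : Matrix (Fin K) (Fin K) ℂ} (hL : L.det ≠ 0)
    (d : Fin K → ℂ) {f : (Fin K → ℂ) → ℝ≥0∞} (hf : Measurable f) :
    ∫⁻ z, ENNReal.ofReal (Real.exp
        (sqLength z - sqLength (L⁻¹.mulVec (z + d)) - Real.log (‖L.det‖ ^ 2))) * f (z + d)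
        ∂noiseLaw K =
      ∫⁻ z, f (L.mulVec z) ∂noiseLaw K := by
  have hu : IsUnit L.det := isUnit_iff_ne_zero.mpr hL
  have hLm : Measurable (fun z : Fin K → ℂ => L.mulVec z) := by
    exact (LinearMap.continuous_of_finiteDimensional L.mulVecLin).measurable
  have hLi : Measurable (fun z : Fin K → ℂ => L⁻¹.mulVec z) := by
    exact (LinearMap.continuous_of_finiteDimensional L⁻¹.mulVecLin).measurable
  have hLd : Measurable (fun z : Fin K → ℂ => L⁻¹.mulVec (z + d)) :=
    hLi.comp (measurable_id.add_const d)
  have hpos : 0 < ‖L.det‖ ^ 2 := by positivity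
  rw [lintegral_noiseLaw (by fun_prop), lintegral_noiseLaw (by fun_prop)]
  -- `F` is the integrand in the output variable. The left side is its integral after a translation,
  -- the right side after the substitution `y = L z`; both equal `‖det L‖⁻²` times the integral of
  -- `F`.
  let F : (Fin K → ℂ) → ℝ≥0∞ := fun y =>
    ENNReal.ofReal (Real.pi⁻¹ ^ K * Real.exp (-sqLength (L⁻¹.mulVec y))) * f y
  have hF : Measurable F := by fun_prop
  have h1 : ∀ z, ENNReal.ofReal (Real.pi⁻¹ ^ K * Real.exp (-sqLength z)) *
      (ENNReal.ofReal (Real.exp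
        (sqLength z - sqLength (L⁻¹.mulVec (z + d)) - Real.log (‖L.det‖ ^ 2))) * f (z + d)) =
      ENNReal.ofReal ((‖L.det‖ ^ 2)⁻¹) * F (z + d) := fun z => by
    simp only [F]
    rw [← mul_assoc, ← mul_assoc, ← ENNReal.ofReal_mul (by positivity),
      ← ENNReal.ofReal_mul (by positivity)]
    congr 2
    rw [Real.exp_sub, Real.exp_log hpos, Real.exp_sub, Real.exp_neg, Real.exp_neg]
    field_simp
  have h2 : ∀ z, ENNReal.ofReal (Real.pi⁻¹ ^ K * Real.exp (-sqLength z)) * f (L.mulVec z) =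
      F (L.mulVec z) := fun z => by
    simp only [F]
    rw [Matrix.mulVec_mulVec, Matrix.nonsing_inv_mul _ hu, Matrix.one_mulVec]
  simp_rw [h1, h2]
  rw [lintegral_const_mul _ (by fun_prop), lintegral_add_right_eq_self F d,
    lintegral_comp_mulVec hL hF]

/-! ### Causal recursions and change of measure along them. -/

section Causal

variable {E : Type*}

/-- The sequence generated causally from the inputs `z`: the `i`-th term is computed by `s i` from
the earlier terms and from `z i`. -/
def causalRun {N : ℕ} (s : (i : Fin N) → (Fin i → E) → E → E) (z : Fin N → E) (i : Fin N) : E :=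
  s i (fun t => causalRun s z ⟨t.1, t.2.trans i.2⟩) (z i)
termination_by i.1
decreasing_by exact t.2

/-- The terms of `causalRun s z` before time `i`. -/
def causalPast {N : ℕ} (s : (i : Fin N) → (Fin i → E) → E → E) (z : Fin N → E) (i : Fin N) :
    Fin i → E :=
  fun t => causalRun s z ⟨t.1, t.2.trans i.2⟩

lemma causalRun_eq {N : ℕ} (s : (i : Fin N) → (Fin i → E) → E → E) (z : Fin N → E) (i : Fin N) :
    causalRun s z i = s i (causalPast s z i) (z i) := by
  rw [causalRun]
  rfl

/-- Both the steps and the inputs may vary: varying the steps compares different messages, while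
varying the inputs serves, through `causalPast_congr`, to flip the sign of one noise. -/
lemma causalRun_congr {N : ℕ} {s s' : (i : Fin N) → (Fin i → E) → E → E} {z z' : Fin N → E}
    (i : Fin N) (h : ∀ j ≤ i, ∀ p, s j p (z j) = s' j p (z' j)) :
    causalRun s z i = causalRun s' z' i := by
  induction i using WellFoundedLT.induction with
  | ind i ih =>
    have hp : causalPast s z i = causalPast s' z' i := funext fun t =>
      ih ⟨t.1, t.2.trans i.2⟩ t.2 fun j hj => h j (hj.trans (Fin.le_def.mpr t.2.le))
    rw [causalRun_eq, causalRun_eq, hp, h i le_rfl]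

lemma causalPast_congr {N : ℕ} {s s' : (i : Fin N) → (Fin i → E) → E → E} {z z' : Fin N → E}
    (i : Fin N) (h : ∀ j < i, ∀ p, s j p (z j) = s' j p (z' j)) :
    causalPast s z i = causalPast s' z' i :=
  funext fun t => causalRun_congr _ fun j hj => h j (hj.trans_lt (Fin.lt_def.mpr t.2))

lemma causalRun_castSucc {N : ℕ} (s : (i : Fin (N + 1)) → (Fin i → E) → E → E)
    (z : Fin N → E) (x : E) (i : Fin N) :
    causalRun s (Fin.snoc z x : Fin (N + 1) → E) i.castSucc =
      causalRun (fun i : Fin N => s i.castSucc) z i := by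
  induction i using WellFoundedLT.induction with
  | ind i ih =>
    rw [causalRun_eq, causalRun_eq, Fin.snoc_castSucc (α := fun _ => E)]
    congr 1
    exact funext fun t => ih ⟨t.1, t.2.trans i.2⟩ t.2

lemma causalPast_castSucc {N : ℕ} (s : (i : Fin (N + 1)) → (Fin i → E) → E → E)
    (z : Fin N → E) (x : E) (i : Fin N) :
    causalPast s (Fin.snoc z x : Fin (N + 1) → E) i.castSucc =
      causalPast (fun i : Fin N => s i.castSucc) z i :=
  funext fun t => causalRun_castSucc s z x ⟨t.1, t.2.trans i.2⟩

lemma causalPast_last {N : ℕ} (s : (i : Fin (N + 1)) → (Fin i → E) → E → E)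
    (z : Fin N → E) (x : E) :
    causalPast s (Fin.snoc z x : Fin (N + 1) → E) (Fin.last N) =
      causalRun (fun i : Fin N => s i.castSucc) z :=
  funext fun t => causalRun_castSucc s z x t

lemma causalRun_snoc {N : ℕ} (s : (i : Fin (N + 1)) → (Fin i → E) → E → E)
    (z : Fin N → E) (x : E) :
    causalRun s (Fin.snoc z x : Fin (N + 1) → E) =
      Fin.snoc (causalRun (fun i : Fin N => s i.castSucc) z)
        (s (Fin.last N) (causalRun (fun i : Fin N => s i.castSucc) z) x) := by
  funext i
  refine Fin.lastCases ?_ (fun i => ?_) i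
  · rw [causalRun_eq, causalPast_last, Fin.snoc_last (α := fun _ => E),
      Fin.snoc_last (α := fun _ => E)]
  · rw [causalRun_castSucc, Fin.snoc_castSucc (α := fun _ => E)]

variable [MeasurableSpace E]

lemma measurable_causalRun_apply {N : ℕ} {s : (i : Fin N) → (Fin i → E) → E → E}
    (hs : ∀ i : Fin N, Measurable fun p : (Fin i → E) × E => s i p.1 p.2) (i : Fin N) :
    Measurable fun z => causalRun s z i := by
  induction i using WellFoundedLT.induction with
  | ind i ih =>
    have hp : Measurable fun z => causalPast s z i :=
      measurable_pi_lambda _ fun t => ih ⟨t.1, t.2.trans i.2⟩ t.2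
    simp_rw [causalRun_eq]
    exact (hs i).comp (hp.prodMk (measurable_pi_apply i))

lemma measurable_causalRun {N : ℕ} {s : (i : Fin N) → (Fin i → E) → E → E}
    (hs : ∀ i : Fin N, Measurable fun p : (Fin i → E) × E => s i p.1 p.2) :
    Measurable (causalRun s) :=
  measurable_pi_lambda _ (measurable_causalRun_apply hs)

lemma measurable_causalPast {N : ℕ} {s : (i : Fin N) → (Fin i → E) → E → E}
    (hs : ∀ i : Fin N, Measurable fun p : (Fin i → E) × E => s i p.1 p.2) (i : Fin N) :
    Measurable fun z => causalPast s z i :=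
  measurable_pi_lambda _ fun _ => measurable_causalRun_apply hs _

lemma measurable_snoc {N : ℕ} :
    Measurable fun p : (Fin N → E) × E => (Fin.snoc p.1 p.2 : Fin (N + 1) → E) := by
  refine measurable_pi_lambda _ fun i => ?_
  refine Fin.lastCases ?_ (fun i => ?_) i
  · simp_rw [Fin.snoc_last (α := fun _ => E)]
    exact measurable_snd
  · simp_rw [Fin.snoc_castSucc (α := fun _ => E)]
    exact (measurable_pi_apply i).comp measurable_fst

lemma lintegral_pi_snoc (ν : Measure E) [SigmaFinite ν] {N : ℕ} {f : (Fin (N + 1) → E) → ℝ≥0∞}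
    (hf : Measurable f) :
    ∫⁻ z, f z ∂(Measure.pi fun _ => ν) =
      ∫⁻ z, ∫⁻ x, f (Fin.snoc z x) ∂ν ∂(Measure.pi fun _ : Fin N => ν) := by
  rw [← (measurePreserving_piFinSuccAbove (fun _ : Fin (N + 1) => ν) (Fin.last N)).symm.lintegral_comp
    hf]
  have h : ∀ p : E × (Fin N → E),
      (MeasurableEquiv.piFinSuccAbove (fun _ => E) (Fin.last N)).symm p = Fin.snoc p.2 p.1 :=
    fun p => Fin.insertNth_last' p.1 p.2
  simp_rw [h]
  exact lintegral_prod_symm' (fun p : E × (Fin N → E) => f (Fin.snoc p.2 p.1))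
    (hf.comp (measurable_snoc.comp measurable_swap))

/-- A change of measure carried out one time step after the other. -/
lemma lintegral_causalRun_change (ν : Measure E) [SigmaFinite ν] {N : ℕ}
    {s s' : (i : Fin N) → (Fin i → E) → E → E} {r : (i : Fin N) → (Fin i → E) → E → ℝ≥0∞}
    (hs : ∀ i : Fin N, Measurable fun p : (Fin i → E) × E => s i p.1 p.2)
    (hs' : ∀ i : Fin N, Measurable fun p : (Fin i → E) × E => s' i p.1 p.2)
    (hr : ∀ i : Fin N, Measurable fun p : (Fin i → E) × E => r i p.1 p.2)
    (hstep : ∀ i p, ∀ f : E → ℝ≥0∞, Measurable f →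
      ∫⁻ x, r i p x * f (s i p x) ∂ν = ∫⁻ x, f (s' i p x) ∂ν)
    {f : (Fin N → E) → ℝ≥0∞} (hf : Measurable f) :
    ∫⁻ z, (∏ i, r i (causalPast s z i) (z i)) * f (causalRun s z) ∂(Measure.pi fun _ => ν) =
      ∫⁻ z, f (causalRun s' z) ∂(Measure.pi fun _ => ν) := by
  induction N with
  | zero =>
    refine lintegral_congr fun z => ?_
    simp only [Finset.univ_eq_empty, Finset.prod_empty, one_mul]
    congr 1
    exact Subsingleton.elim _ _
  | succ N ih =>
    have hprod : ∀ {N : ℕ} {s : (i : Fin N) → (Fin i → E) → E → E}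
        {r : (i : Fin N) → (Fin i → E) → E → ℝ≥0∞}
        (_ : ∀ i : Fin N, Measurable fun p : (Fin i → E) × E => s i p.1 p.2)
        (_ : ∀ i : Fin N, Measurable fun p : (Fin i → E) × E => r i p.1 p.2),
        Measurable fun z : Fin N → E => ∏ i, r i (causalPast s z i) (z i) :=
      fun hs hr => Finset.measurable_prod _ fun i _ =>
        (hr i).comp ((measurable_causalPast hs i).prodMk (measurable_pi_apply i))
    have h1 : Measurable fun z => f (causalRun s z) := hf.comp (measurable_causalRun hs)
    have h2 : Measurable fun z => f (causalRun s' z) := hf.comp (measurable_causalRun hs')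
    rw [lintegral_pi_snoc ν ((hprod hs hr).fun_mul h1), lintegral_pi_snoc ν h2]
    simp_rw [Fin.prod_univ_castSucc, causalRun_snoc, causalPast_castSucc, causalPast_last,
      Fin.snoc_castSucc (α := fun _ => E), Fin.snoc_last (α := fun _ => E), mul_assoc]
    -- `H` integrates out the last time step as a function of the earlier outputs. The one-step
    -- hypothesis turns the last factor into `H`, and the induction hypothesis is applied to `H`.
    let H : (Fin N → E) → ℝ≥0∞ := fun p => ∫⁻ x, f (Fin.snoc p (s' (Fin.last N) p x)) ∂ν
    have hH : Measurable H := by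
      refine Measurable.lintegral_prod_right' (f := fun q : (Fin N → E) × E =>
        f (Fin.snoc q.1 (s' (Fin.last N) q.1 q.2))) ?_
      exact hf.comp (measurable_snoc.comp (measurable_fst.prodMk (hs' (Fin.last N))))
    rw [show (∫⁻ z, ∫⁻ x, f (Fin.snoc (causalRun (fun i : Fin N => s' i.castSucc) z)
        (s' (Fin.last N) (causalRun (fun i : Fin N => s' i.castSucc) z) x)) ∂ν
          ∂(Measure.pi fun _ : Fin N => ν)) =
        ∫⁻ z, H (causalRun (fun i : Fin N => s' i.castSucc) z) ∂(Measure.pi fun _ => ν) from rfl,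
      ← ih (fun i => hs i.castSucc) (fun i => hs' i.castSucc) (fun i => hr i.castSucc)
        (fun i => hstep i.castSucc) hH]
    refine lintegral_congr fun z => ?_
    set p := causalRun (fun i : Fin N => s i.castSucc) z
    have hsn : Measurable fun e : E => f (Fin.snoc p e) :=
      hf.comp (measurable_snoc.comp measurable_prodMk_left)
    rw [lintegral_const_mul]
    · congr 1
      exact hstep (Fin.last N) p (fun e => f (Fin.snoc p e)) hsn
    · exact ((hr (Fin.last N)).comp measurable_prodMk_left).mul
        (hsn.comp ((hs (Fin.last N)).comp measurable_prodMk_left))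

end Causal

/-! ### Matrix root, second moments, and the abstract weak converse. -/

/-- The Hermitian square root serves as the noise matrix of the auxiliary channel. -/
lemma exists_mul_conjTranspose_eq_one_add {n : Type*} [Fintype n] [DecidableEq n]
    {V : Matrix n n ℂ} (hV : V.PosSemidef) :
    ∃ L : Matrix n n ℂ, L.det ≠ 0 ∧ L * L.conjTranspose = 1 + V := by
  have hpd : (1 + V).PosDef := Matrix.PosDef.one.add_posSemidef hV
  obtain ⟨X, hX, -, h⟩ :=
    CFC.exists_sqrt_of_isSelfAdjoint_of_quasispectrumRestricts hpd.isHermitian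
      (by
        open scoped MatrixOrder in
        exact QuasispectrumRestricts.nnreal_of_nonneg hpd.posSemidef.nonneg)
  have hL : X * X.conjTranspose = 1 + V := by
    rw [← Matrix.star_eq_conjTranspose, hX.star_eq]
    exact h
  refine ⟨X, fun h0 => hpd.det_pos.ne' ?_, hL⟩
  rw [← hL, Matrix.det_mul, h0, zero_mul]

/-- If a measure-preserving map flips the sign of `u` and fixes `v`, then `u` and `v` are
orthogonal. -/
lemma lintegral_sq_enorm_add_of_flip {Ω : Type*} [MeasurableSpace Ω] {μ : Measure Ω} {Φ : Ω → Ω}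
    (hΦ : MeasurePreserving Φ μ μ) {u v : Ω → ℂ} (hu : Measurable u) (hv : Measurable v)
    (hΦu : ∀ x, u (Φ x) = -u x) (hΦv : ∀ x, v (Φ x) = v x) :
    ∫⁻ x, ‖u x + v x‖ₑ ^ 2 ∂μ = ∫⁻ x, ‖u x‖ₑ ^ 2 ∂μ + ∫⁻ x, ‖v x‖ₑ ^ 2 ∂μ := by
  have h1 : ∫⁻ x, ‖-u x + v x‖ₑ ^ 2 ∂μ = ∫⁻ x, ‖u x + v x‖ₑ ^ 2 ∂μ := by
    rw [← hΦ.lintegral_comp (f := fun x => ‖u x + v x‖ₑ ^ 2) (by fun_prop)]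
    simp_rw [hΦu, hΦv]
  -- The parallelogram law replaces independence and expansion of the square; with lower integrals
  -- no integrability is needed.
  have hpar : ∀ a b : ℂ, ‖a + b‖ₑ ^ 2 + ‖-a + b‖ₑ ^ 2 = 2 * (‖a‖ₑ ^ 2 + ‖b‖ₑ ^ 2) := fun a b => by
    have h := parallelogram_law_with_norm ℝ a b
    have hab : ‖-a + b‖ = ‖a - b‖ := by rw [← norm_neg]; congr 1; ring
    simp_rw [← ofReal_norm, ← ENNReal.ofReal_pow (norm_nonneg _)]
    rw [← ENNReal.ofReal_add (by positivity) (by positivity),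
      ← ENNReal.ofReal_add (by positivity) (by positivity),
      show (2 : ℝ≥0∞) = ENNReal.ofReal 2 by simp, ← ENNReal.ofReal_mul (by norm_num), hab]
    congr 1
  have h2 : 2 * ∫⁻ x, ‖u x + v x‖ₑ ^ 2 ∂μ =
      2 * (∫⁻ x, ‖u x‖ₑ ^ 2 ∂μ + ∫⁻ x, ‖v x‖ₑ ^ 2 ∂μ) := by
    rw [two_mul]
    nth_rw 2 [← h1]
    rw [← lintegral_add_left (by fun_prop), ← lintegral_add_left (by fun_prop)]
    simp_rw [hpar]
    rw [lintegral_const_mul _ (by fun_prop)]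
  exact (ENNReal.mul_right_inj (by norm_num) (by norm_num)).mp h2

lemma measurePreserving_flip {ι E : Type*} [Fintype ι] [DecidableEq ι] [MeasurableSpace E]
    [Neg E] {ν : Measure E} [SigmaFinite ν] (hν : MeasurePreserving (fun x : E => -x) ν ν) (i : ι) :
    MeasurePreserving (fun (z : ι → E) j => if j = i then -z j else z j)
      (Measure.pi fun _ => ν) (Measure.pi fun _ => ν) := by
  refine measurePreserving_pi (fun _ => ν) (fun _ => ν)
    (f := fun j x => if j = i then -x else x) fun j => ?_
  by_cases h : j = i
  · simpa [h] using hν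
  · simpa [h] using! MeasurePreserving.id ν

lemma measurePreserving_neg_noiseLaw (K : ℕ) :
    MeasurePreserving (fun z : Fin K → ℂ => -z) (noiseLaw K) (noiseLaw K) :=
  measurePreserving_pi (fun _ => stdComplexGaussian) (fun _ => stdComplexGaussian)
    (f := fun _ x => -x) fun _ => measurePreserving_neg_stdComplexGaussian

lemma lintegral_sq_enorm_dotProduct_noiseLaw {K : ℕ} (a : Fin K → ℂ) :
    ∫⁻ z, ‖a ⬝ᵥ z‖ₑ ^ 2 ∂noiseLaw K = ENNReal.ofReal (sqLength a) := by
  have h : ∀ s : Finset (Fin K), ∫⁻ z : Fin K → ℂ, ‖∑ k ∈ s, a k * z k‖ₑ ^ 2 ∂noiseLaw K =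
      ∑ k ∈ s, ENNReal.ofReal (‖a k‖ ^ 2) := fun s => by
    induction s using Finset.induction_on with
    | empty => simp
    | insert k s hk ih =>
      simp_rw [Finset.sum_insert hk]
      rw [lintegral_sq_enorm_add_of_flip
        (measurePreserving_flip measurePreserving_neg_stdComplexGaussian k)
        (by fun_prop) (by fun_prop) (by simp), ih]
      · congr 1
        simp_rw [enorm_mul, mul_pow]
        rw [lintegral_const_mul _ (by fun_prop),
          (measurePreserving_eval (fun _ : Fin K => stdComplexGaussian) k).lintegral_comp
            (f := fun z => ‖z‖ₑ ^ 2) (by fun_prop), lintegral_sq_enorm_stdComplexGaussian,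
          mul_one, ← ofReal_norm, ENNReal.ofReal_pow (norm_nonneg _)]
      · intro z
        refine Finset.sum_congr rfl fun j hj => ?_
        simp only [if_neg (ne_of_mem_of_not_mem hj hk)]
  rw [sqLength, ENNReal.ofReal_sum_of_nonneg fun _ _ => by positivity]
  exact h Finset.univ

/-- The weak converse by change of measure: if `exp (-T)` is the density with respect to `μ` of a
subprobability under which the event `A` has probability at most `1 / q`, then `μ A` is small. -/
lemma measureReal_mul_log_le {Ω : Type*} [MeasurableSpace Ω] {μ : Measure Ω}
    [IsProbabilityMeasure μ] {T : Ω → ℝ} (hTm : Measurable T) (hT : Integrable T μ) {A : Set Ω}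
    (hA : MeasurableSet A) {q : ℝ} (hq : 0 < q)
    (h1 : ∫⁻ x, ENNReal.ofReal (Real.exp (-T x)) ∂μ ≤ 1)
    (hqA : ∫⁻ x in A, ENNReal.ofReal (Real.exp (-T x)) ∂μ ≤ ENNReal.ofReal q⁻¹) :
    μ.real A * Real.log q ≤ 1 + ∫ x, T x ∂μ := by
  have hm : Measurable fun x => Real.exp (-T x) := by fun_prop
  have hint : Integrable (fun x => Real.exp (-T x)) μ := by
    refine ⟨hm.aestronglyMeasurable, ?_⟩
    rw [hasFiniteIntegral_iff_ofReal (ae_of_all _ fun _ => (Real.exp_pos _).le)]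
    exact h1.trans_lt ENNReal.one_lt_top
  have e1 : ∫ x, Real.exp (-T x) ∂μ ≤ 1 := by
    rw [integral_eq_lintegral_of_nonneg_ae (ae_of_all _ fun _ => (Real.exp_pos _).le)
      hm.aestronglyMeasurable]
    exact ENNReal.toReal_le_of_le_ofReal zero_le_one (by simpa using h1)
  have e2 : ∫ x in A, Real.exp (-T x) ∂μ ≤ q⁻¹ := by
    rw [integral_eq_lintegral_of_nonneg_ae (ae_of_all _ fun _ => (Real.exp_pos _).le)
      hm.aestronglyMeasurable]
    exact ENNReal.toReal_le_of_le_ofReal (by positivity) hqA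
  -- Both cases are `x + 1 ≤ exp x`, at `log q - T` on `A` and at `-T` off `A`. After integration
  -- the two exponential terms contribute at most `1` each, which with the `-1` leaves the constant
  -- `1`.
  have hpt : ∀ x, A.indicator (fun _ => Real.log q) x ≤
      T x + (Real.exp (-T x) + A.indicator (fun x => q * Real.exp (-T x)) x - 1) := fun x => by
    by_cases hx : x ∈ A
    · rw [Set.indicator_of_mem hx, Set.indicator_of_mem hx]
      have h := Real.add_one_le_exp (Real.log q - T x)
      rw [Real.exp_sub, Real.exp_log hq] at h
      have h' := Real.exp_pos (-T x)
      rw [Real.exp_neg] at *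
      rw [div_eq_mul_inv] at h
      linarith
    · rw [Set.indicator_of_notMem hx, Set.indicator_of_notMem hx]
      linarith [Real.add_one_le_exp (-T x)]
  have hi1 : Integrable (A.indicator fun x => q * Real.exp (-T x)) μ :=
    (hint.const_mul q).indicator hA
  have hi2 : Integrable (A.indicator fun _ => Real.log q) μ :=
    (integrable_const _).indicator hA
  have h := integral_mono hi2 (hT.add ((hint.add hi1).sub (integrable_const 1))) hpt
  rw [integral_indicator hA, integral_add' hT ((hint.add hi1).sub (integrable_const 1)),
    integral_sub' (hint.add hi1) (integrable_const 1), integral_add' hint hi1,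
    integral_indicator hA, integral_const_mul, setIntegral_const] at h
  simp only [integral_const, probReal_univ, smul_eq_mul, mul_one] at h
  have h3 : q * ∫ x in A, Real.exp (-T x) ∂μ ≤ 1 := by
    calc _ ≤ q * q⁻¹ := by gcongr
      _ = 1 := mul_inv_cancel₀ hq.ne'
  linarith

/-! ### Averages over uniform messages. -/

lemma lintegral_jointLaw {M K N : ℕ} {L : Fin M → ℕ} (hL : ∀ m, 0 < L m)
    {f : ((m : Fin M) → Fin (L m)) × (Fin N → Fin K → ℂ) → ℝ≥0∞} (hf : Measurable f) :
    ∫⁻ p, f p ∂jointLaw K N L =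
      (∏ m, (L m : ℝ≥0∞))⁻¹ * ∑ w, ∫⁻ z, f (w, z) ∂(Measure.pi fun _ => noiseLaw K) := by
  have : ∀ m, Nonempty (Fin (L m)) := fun m => ⟨⟨0, hL m⟩⟩
  have : ∀ m, IsProbabilityMeasure (uniformOn (Set.univ : Set (Fin (L m)))) := fun m =>
    isProbabilityMeasure_uniformOn Set.finite_univ Set.univ_nonempty
  rw [jointLaw, lintegral_prod _ hf.aemeasurable, lintegral_fintype, Finset.mul_sum]
  refine Finset.sum_congr rfl fun w _ => ?_
  rw [Measure.pi_singleton, mul_comm]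
  congr 1
  simp_rw [uniformOn_univ]
  rw [ENNReal.prod_inv_distrib fun _ _ _ _ _ => Or.inr (ENNReal.natCast_ne_top _)]
  simp

lemma isProbabilityMeasure_jointLaw (K N : ℕ) {M : ℕ} {L : Fin M → ℕ} (hL : ∀ m, 0 < L m) :
    IsProbabilityMeasure (jointLaw K N L) := by
  have : ∀ m, Nonempty (Fin (L m)) := fun m => ⟨⟨0, hL m⟩⟩
  have : ∀ m, IsProbabilityMeasure (uniformOn (Set.univ : Set (Fin (L m)))) := fun m =>
    isProbabilityMeasure_uniformOn Set.finite_univ Set.univ_nonempty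
  unfold jointLaw
  infer_instance

/-- A guess of all coordinates of `w` from those outside `S` is right for few `w`. -/
lemma card_fixedPoints_le {M : ℕ} {L : Fin M → ℕ} (S : Finset (Fin M))
    (D : ((m : Fin M) → Fin (L m)) → ((m : Fin M) → Fin (L m)))
    (hD : ∀ w w', (∀ m ∉ S, w m = w' m) → D w = D w') :
    (Finset.univ.filter fun w => D w = w).card ≤ ∏ m ∈ Sᶜ, L m := by
  calc _ ≤ (Finset.univ : Finset ((m : {m // m ∈ Sᶜ}) → Fin (L m))).card := by
        refine Finset.card_le_card_of_injOn (fun w m => w m.1) (fun _ _ => Finset.mem_univ _) ?_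
        intro w hw w' hw' h
        simp only [Finset.coe_filter, Finset.mem_univ, true_and, Set.mem_ofPred_eq] at hw hw'
        rw [← hw, ← hw']
        exact hD w w' fun m hm => congrFun h ⟨m, Finset.mem_compl.mpr hm⟩
    _ = ∏ m ∈ Sᶜ, L m := by
        rw [Finset.card_univ, Fintype.card_pi]
        simp only [Fintype.card_fin]
        exact Finset.prod_coe_sort Sᶜ L

/-! ### The auxiliary channel and its likelihood ratio. -/

namespace FeedbackCode

variable {M K N : ℕ} {L : Fin M → ℕ}

/-- The matrix of all gains, a row for each receiver. -/
abbrev gains (g : Fin M → Fin K → ℂ) : Matrix (Fin K) (Fin M) ℂ := Matrix.of fun k m => g m k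

/-- The linear image under `B` of the vector of inputs at time `i` when the messages are `w` and
the earlier outputs are `p`. -/
def mix (c : FeedbackCode M K N L) (B : Matrix (Fin K) (Fin M) ℂ) (w : (m : Fin M) → Fin (L m))
    (i : Fin N) (p : Fin i → Fin K → ℂ) : Fin K → ℂ :=
  B.mulVec fun m => c.enc m i (w m) p

/-- The output at time `i` of the channel with gains `B` and noise `A e`. -/
def step (c : FeedbackCode M K N L) (B : Matrix (Fin K) (Fin M) ℂ) (A : Matrix (Fin K) (Fin K) ℂ)
    (w : (m : Fin M) → Fin (L m)) (i : Fin N) (p : Fin i → Fin K → ℂ) (e : Fin K → ℂ) :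
    Fin K → ℂ :=
  c.mix B w i p + A.mulVec e

/-- The outputs before time `i` when the messages are `w` and the noise is `z`. -/
abbrev past (c : FeedbackCode M K N L) (g : Fin M → Fin K → ℂ) (w : (m : Fin M) → Fin (L m))
    (z : Fin N → Fin K → ℂ) (i : Fin N) : Fin i → Fin K → ℂ :=
  causalPast (c.step (gains g) 1 w) z i

lemma output_eq_causalRun (c : FeedbackCode M K N L) (g : Fin M → Fin K → ℂ)
    (w : (m : Fin M) → Fin (L m)) (z : Fin N → Fin K → ℂ) :
    c.output g w z = causalRun (c.step (gains g) 1 w) z := by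
  funext i
  induction i using WellFoundedLT.induction with
  | ind i ih =>
    have hp : (fun t : Fin i => c.output g w z ⟨t.1, t.2.trans i.2⟩) = c.past g w z i :=
      funext fun t => ih ⟨t.1, t.2.trans i.2⟩ t.2
    funext k
    rw [causalRun_eq, output, hp, step, Matrix.one_mulVec]
    rfl

lemma input_eq (c : FeedbackCode M K N L) (g : Fin M → Fin K → ℂ)
    (w : (m : Fin M) → Fin (L m)) (z : Fin N → Fin K → ℂ) (m : Fin M) (i : Fin N) :
    c.input g w z m i = c.enc m i (w m) (c.past g w z i) := by
  rw [input, output_eq_causalRun]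
  rfl

lemma measurable_mulVec {m n : ℕ} (A : Matrix (Fin m) (Fin n) ℂ) :
    Measurable fun v : Fin n → ℂ => A.mulVec v :=
  (LinearMap.continuous_of_finiteDimensional A.mulVecLin).measurable

lemma measurable_mix (c : FeedbackCode M K N L) (B : Matrix (Fin K) (Fin M) ℂ)
    (w : (m : Fin M) → Fin (L m)) (i : Fin N) : Measurable (c.mix B w i) :=
  (measurable_mulVec B).comp (measurable_pi_lambda _ fun m => c.measurable_enc m i (w m))

lemma measurable_step (c : FeedbackCode M K N L) (B : Matrix (Fin K) (Fin M) ℂ)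
    (A : Matrix (Fin K) (Fin K) ℂ) (w : (m : Fin M) → Fin (L m)) (i : Fin N) :
    Measurable fun p : (Fin i → Fin K → ℂ) × (Fin K → ℂ) => c.step B A w i p.1 p.2 :=
  ((c.measurable_mix B w i).comp measurable_fst).add ((measurable_mulVec A).comp measurable_snd)

lemma measurable_past (c : FeedbackCode M K N L) (g : Fin M → Fin K → ℂ)
    (w : (m : Fin M) → Fin (L m)) (i : Fin N) : Measurable fun z => c.past g w z i :=
  measurable_causalPast (c.measurable_step _ _ w) i

lemma measurable_input (c : FeedbackCode M K N L) (g : Fin M → Fin K → ℂ) (m : Fin M)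
    (i : Fin N) :
    Measurable fun p : ((m : Fin M) → Fin (L m)) × (Fin N → Fin K → ℂ) =>
      c.input g p.1 p.2 m i := by
  refine measurable_from_prod_countable_right fun w => ?_
  simp_rw [input_eq]
  exact (c.measurable_enc m i (w m)).comp (c.measurable_past g w i)

lemma measurable_mix_past (c : FeedbackCode M K N L) (g : Fin M → Fin K → ℂ)
    (B : Matrix (Fin K) (Fin M) ℂ) (i : Fin N) :
    Measurable fun p : ((m : Fin M) → Fin (L m)) × (Fin N → Fin K → ℂ) =>
      c.mix B p.1 i (c.past g p.1 p.2 i) :=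
  measurable_from_prod_countable_right fun w =>
    (c.measurable_mix B w i).comp (c.measurable_past g w i)

lemma measurable_output (c : FeedbackCode M K N L) (g : Fin M → Fin K → ℂ) :
    Measurable fun p : ((m : Fin M) → Fin (L m)) × (Fin N → Fin K → ℂ) =>
      c.output g p.1 p.2 := by
  refine measurable_from_prod_countable_right fun w => ?_
  simp_rw [output_eq_causalRun]
  exact measurable_causalRun (c.measurable_step _ _ w)

/-- The logarithm of the likelihood ratio between the channel and the auxiliary channel with gains
`gains g - B` and noise `A e`. -/
def logRatio (c : FeedbackCode M K N L) (g : Fin M → Fin K → ℂ) (B : Matrix (Fin K) (Fin M) ℂ)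
    (A : Matrix (Fin K) (Fin K) ℂ)
    (p : ((m : Fin M) → Fin (L m)) × (Fin N → Fin K → ℂ)) : ℝ :=
  ∑ i, (Real.log (‖A.det‖ ^ 2) + sqLength (A⁻¹.mulVec (p.2 i + c.mix B p.1 i (c.past g p.1 p.2 i))) -
    sqLength (p.2 i))

lemma measurable_logRatio (c : FeedbackCode M K N L) (g : Fin M → Fin K → ℂ)
    (B : Matrix (Fin K) (Fin M) ℂ) (A : Matrix (Fin K) (Fin K) ℂ) :
    Measurable (c.logRatio g B A) := by
  refine Finset.measurable_sum _ fun i _ => ?_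
  have h2 : Measurable fun p : ((m : Fin M) → Fin (L m)) × (Fin N → Fin K → ℂ) => p.2 i :=
    (measurable_pi_apply i).comp measurable_snd
  exact (measurable_const.add (measurable_sqLength.comp ((measurable_mulVec A⁻¹).comp
    (h2.add (c.measurable_mix_past g B i))))).sub (measurable_sqLength.comp h2)

/-- Relative to the auxiliary mean `(gains g - B) x`, the true output `gains g x + z` has residual
`z + B x`. Each factor of the ratio is thus a Gaussian change of measure with shift `B x`, a
function of the past, and the factors multiply causally. -/
lemma lintegral_exp_neg_logRatio (c : FeedbackCode M K N L) (g : Fin M → Fin K → ℂ)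
    (B : Matrix (Fin K) (Fin M) ℂ) {A : Matrix (Fin K) (Fin K) ℂ} (hA : A.det ≠ 0)
    (w : (m : Fin M) → Fin (L m)) {f : (Fin N → Fin K → ℂ) → ℝ≥0∞} (hf : Measurable f) :
    ∫⁻ z, ENNReal.ofReal (Real.exp (-c.logRatio g B A (w, z))) * f (c.output g w z)
        ∂(Measure.pi fun _ => noiseLaw K) =
      ∫⁻ z, f (causalRun (c.step (gains g - B) A w) z) ∂(Measure.pi fun _ => noiseLaw K) := by
  rw [← lintegral_causalRun_change (noiseLaw K) (s := c.step (gains g) 1 w)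
    (r := fun i p e => ENNReal.ofReal (Real.exp
      (sqLength e - sqLength (A⁻¹.mulVec (e + c.mix B w i p)) - Real.log (‖A.det‖ ^ 2))))
    (c.measurable_step _ _ w) (c.measurable_step _ _ w) ?_ ?_ hf]
  · refine lintegral_congr fun z => ?_
    rw [output_eq_causalRun, ← ENNReal.ofReal_prod_of_nonneg fun _ _ => (Real.exp_pos _).le,
      ← Real.exp_sum, logRatio, ← Finset.sum_neg_distrib]
    congr 3
    refine Finset.sum_congr rfl fun i _ => ?_
    ring
  · intro i
    have h := (c.measurable_mix B w i).comp
      (measurable_fst : Measurable fun p : (Fin i → Fin K → ℂ) × (Fin K → ℂ) => p.1)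
    have h' : Measurable fun p : (Fin i → Fin K → ℂ) × (Fin K → ℂ) =>
        A⁻¹.mulVec (p.2 + c.mix B w i p.1) :=
      (measurable_mulVec A⁻¹).comp (measurable_snd.add h)
    fun_prop
  · intro i p f hf
    have h := lintegral_noiseLaw_change hA (c.mix B w i p)
      (f := fun u => f (c.mix (gains g - B) w i p + u)) (by fun_prop)
    refine Eq.trans ?_ h
    refine lintegral_congr fun z => ?_
    congr 2
    rw [step, Matrix.one_mulVec, mix, mix, mix, Matrix.sub_mulVec]
    abel

/-- The auxiliary channel makes it hard to guess the messages in `S`. -/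
lemma setLIntegral_exp_neg_logRatio_le (c : FeedbackCode M K N L) (g : Fin M → Fin K → ℂ)
    (hL : ∀ m, 0 < L m) (B : Matrix (Fin K) (Fin M) ℂ) {A : Matrix (Fin K) (Fin K) ℂ}
    (hA : A.det ≠ 0) (S : Finset (Fin M)) (k : Fin K)
    (hS : ∀ w w' z i, (∀ m ∉ S, w m = w' m) →
      causalRun (c.step (gains g - B) A w) z i k = causalRun (c.step (gains g - B) A w') z i k) :
    ∫⁻ p in {p | c.dec k (fun i => c.output g p.1 p.2 i k) = p.1},
        ENNReal.ofReal (Real.exp (-c.logRatio g B A p)) ∂jointLaw K N L ≤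
      ENNReal.ofReal (∏ m ∈ S, (L m : ℝ))⁻¹ := by
  have hdec : Measurable fun y : Fin N → Fin K → ℂ => c.dec k fun i => y i k :=
    (c.measurable_dec k).comp (by fun_prop)
  have hset : MeasurableSet {p : ((m : Fin M) → Fin (L m)) × (Fin N → Fin K → ℂ) |
      c.dec k (fun i => c.output g p.1 p.2 i k) = p.1} :=
    measurableSet_eq_fun (hdec.comp (c.measurable_output g)) measurable_fst
  have hexp : Measurable fun p => ENNReal.ofReal (Real.exp (-c.logRatio g B A p)) :=
    ((c.measurable_logRatio g B A).neg.exp).ennreal_ofReal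
  rw [← lintegral_indicator hset, lintegral_jointLaw hL (hexp.indicator hset)]
  have h1 : ∀ w, ∫⁻ z, {p : ((m : Fin M) → Fin (L m)) × (Fin N → Fin K → ℂ) |
      c.dec k (fun i => c.output g p.1 p.2 i k) = p.1}.indicator
        (fun p => ENNReal.ofReal (Real.exp (-c.logRatio g B A p))) (w, z)
          ∂(Measure.pi fun _ => noiseLaw K) =
      ∫⁻ z, {y : Fin N → Fin K → ℂ | (c.dec k fun i => y i k) = w}.indicator 1
        (causalRun (c.step (gains g - B) A w) z) ∂(Measure.pi fun _ => noiseLaw K) := fun w => by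
    have hm : Measurable ({y : Fin N → Fin K → ℂ | (c.dec k fun i => y i k) = w}.indicator
        (1 : (Fin N → Fin K → ℂ) → ℝ≥0∞)) :=
      measurable_one.indicator (hdec (measurableSet_singleton w))
    rw [← c.lintegral_exp_neg_logRatio g B hA w hm]
    refine lintegral_congr fun z => ?_
    by_cases h : (c.dec k fun i => c.output g w z i k) = w <;> simp [h]
  simp_rw [h1]
  rw [← lintegral_finsetSum]
  swap
  · intro w _
    exact (measurable_one.indicator (hdec (measurableSet_singleton w))).comp
      (measurable_causalRun (c.measurable_step _ _ w))
  -- With the noise fixed, what receiver `k` sees in the auxiliary channel depends only on the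
  -- messages outside `S`; this bounds the number of message tuples decoded correctly.
  have h2 : ∀ z : Fin N → Fin K → ℂ, ∑ w, {y : Fin N → Fin K → ℂ |
      (c.dec k fun i => y i k) = w}.indicator (1 : (Fin N → Fin K → ℂ) → ℝ≥0∞)
        (causalRun (c.step (gains g - B) A w) z) ≤ ∏ m ∈ Sᶜ, (L m : ℝ≥0∞) := fun z => by
    have h := card_fixedPoints_le S
      (fun w => c.dec k fun i => causalRun (c.step (gains g - B) A w) z i k)
      fun w w' hw => by
        congr 1
        exact funext fun i => hS w w' z i hw
    have h' : ((Finset.univ.filter fun w =>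
        (c.dec k fun i => causalRun (c.step (gains g - B) A w) z i k) = w).card : ℝ≥0∞) ≤
          ∏ m ∈ Sᶜ, (L m : ℝ≥0∞) := by exact_mod_cast h
    refine le_trans (le_of_eq ?_) h'
    rw [Finset.card_filter]
    push_cast
    refine Finset.sum_congr rfl fun w _ => ?_
    simp [Set.indicator_apply]
  have hne : ∀ m, (L m : ℝ≥0∞) ≠ 0 := fun m => by exact_mod_cast (hL m).ne'
  calc _ ≤ (∏ m, (L m : ℝ≥0∞))⁻¹ * ∫⁻ _, ∏ m ∈ Sᶜ, (L m : ℝ≥0∞)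
        ∂(Measure.pi fun _ : Fin N => noiseLaw K) := by
        gcongr with z
        exact h2 z
    _ = ENNReal.ofReal (∏ m ∈ S, (L m : ℝ))⁻¹ := by
        have hpos : 0 < ∏ m ∈ S, (L m : ℝ) :=
          Finset.prod_pos fun m _ => by exact_mod_cast hL m
        have hof : ENNReal.ofReal (∏ m ∈ S, (L m : ℝ)) = ∏ m ∈ S, (L m : ℝ≥0∞) := by
          rw [ENNReal.ofReal_prod_of_nonneg fun _ _ => by positivity]
          simp
        rw [lintegral_const, measure_univ, mul_one, ENNReal.ofReal_inv_of_pos hpos, hof,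
          ← Finset.prod_mul_prod_compl S, ENNReal.mul_inv (Or.inl ?_) (Or.inl ?_), mul_assoc,
          ENNReal.inv_mul_cancel, mul_one]
        · exact Finset.prod_ne_zero_iff.mpr fun m _ => hne m
        · exact ENNReal.prod_ne_top fun m _ => ENNReal.natCast_ne_top _
        · exact Finset.prod_ne_zero_iff.mpr fun m _ => hne m
        · exact ENNReal.prod_ne_top fun m _ => ENNReal.natCast_ne_top _

lemma lintegral_exp_neg_logRatio_jointLaw (c : FeedbackCode M K N L) (g : Fin M → Fin K → ℂ)
    (hL : ∀ m, 0 < L m) (B : Matrix (Fin K) (Fin M) ℂ) {A : Matrix (Fin K) (Fin K) ℂ}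
    (hA : A.det ≠ 0) :
    ∫⁻ p, ENNReal.ofReal (Real.exp (-c.logRatio g B A p)) ∂jointLaw K N L = 1 := by
  have hexp : Measurable fun p => ENNReal.ofReal (Real.exp (-c.logRatio g B A p)) :=
    ((c.measurable_logRatio g B A).neg.exp).ennreal_ofReal
  have := isProbabilityMeasure_jointLaw K N hL
  have hone := lintegral_jointLaw (K := K) (N := N) hL (f := 1) measurable_one
  simp only [Pi.one_apply, lintegral_const, measure_univ, mul_one] at hone
  rw [lintegral_jointLaw hL hexp]
  have h1 : ∀ w, ∫⁻ z, ENNReal.ofReal (Real.exp (-c.logRatio g B A (w, z)))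
      ∂(Measure.pi fun _ => noiseLaw K) = 1 := fun w => by
    have h := c.lintegral_exp_neg_logRatio g B hA w (f := 1) measurable_one
    simpa using h
  simp_rw [h1]
  exact hone.symm

end FeedbackCode

/-! ### The mean of the log-likelihood ratio and the weak converse. -/

lemma sqLength_nonneg {K : ℕ} (v : Fin K → ℂ) : 0 ≤ sqLength v :=
  Finset.sum_nonneg fun _ _ => sq_nonneg _

lemma ofReal_sqLength_mulVec {K : ℕ} (A : Matrix (Fin K) (Fin K) ℂ) (v : Fin K → ℂ) :
    ENNReal.ofReal (sqLength (A.mulVec v)) = ∑ j, ‖A j ⬝ᵥ v‖ₑ ^ 2 := by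
  rw [sqLength, ENNReal.ofReal_sum_of_nonneg fun _ _ => by positivity]
  refine Finset.sum_congr rfl fun j _ => ?_
  rw [ENNReal.ofReal_pow (norm_nonneg _), ofReal_norm]
  rfl

/-- This is the trace of `A⁻¹ (1 + V) A⁻¹ᴴ = 1`: `A⁻¹` whitens a vector of covariance `1 + V`. -/
lemma sum_sqLength_add_re_rows {K : ℕ} {A V : Matrix (Fin K) (Fin K) ℂ} (hA : A.det ≠ 0)
    (hV : A * A.conjTranspose = 1 + V) :
    ∑ j, (sqLength (A⁻¹ j) + (A⁻¹ j ⬝ᵥ V.mulVec (star (A⁻¹ j))).re) = K := by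
  have hu : IsUnit A.det := isUnit_iff_ne_zero.mpr hA
  have h1 : A⁻¹ * (1 + V) * A⁻¹.conjTranspose = 1 := by
    rw [← hV, ← Matrix.mul_assoc, Matrix.nonsing_inv_mul _ hu, Matrix.one_mul,
      ← Matrix.conjTranspose_mul, Matrix.nonsing_inv_mul _ hu, Matrix.conjTranspose_one]
  have h2 : ∀ j, sqLength (A⁻¹ j) + (A⁻¹ j ⬝ᵥ V.mulVec (star (A⁻¹ j))).re =
      ((A⁻¹ * (1 + V) * A⁻¹.conjTranspose) j j).re := fun j => by
    have h3 : (A⁻¹ * (1 + V) * A⁻¹.conjTranspose) j j =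
        A⁻¹ j ⬝ᵥ (1 + V).mulVec (star (A⁻¹ j)) := by
      rw [Matrix.mul_assoc]
      rfl
    rw [h3, Matrix.add_mulVec, Matrix.one_mulVec, dotProduct_add, Complex.add_re]
    congr 1
    rw [sqLength, dotProduct, Complex.re_sum]
    refine Finset.sum_congr rfl fun k _ => ?_
    rw [Pi.star_apply, RCLike.star_def, Complex.mul_conj, Complex.ofReal_re, Complex.sq_norm]
  simp_rw [h2, h1]
  simp

namespace FeedbackCode

variable {M K N : ℕ} {L : Fin M → ℕ}

lemma lintegral_comp_noise (hL : ∀ m, 0 < L m) (i : Fin N) {f : (Fin K → ℂ) → ℝ≥0∞}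
    (hf : Measurable f) :
    ∫⁻ p, f (p.2 i) ∂jointLaw K N L = ∫⁻ z, f z ∂noiseLaw K := by
  have : ∀ m, Nonempty (Fin (L m)) := fun m => ⟨⟨0, hL m⟩⟩
  have : ∀ m, IsProbabilityMeasure (uniformOn (Set.univ : Set (Fin (L m)))) := fun m =>
    isProbabilityMeasure_uniformOn Set.finite_univ Set.univ_nonempty
  exact ((measurePreserving_eval (fun _ : Fin N => noiseLaw K) i).comp
    (measurePreserving_snd (μ := Measure.pi fun m =>
      uniformOn (Set.univ : Set (Fin (L m)))))).lintegral_comp hf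

/-- Fresh noise is orthogonal to the inputs: flipping the sign of the noise at time `i` alone
preserves the joint law and leaves the inputs at time `i` unchanged, since feedback reaches only
earlier noises. -/
lemma lintegral_sq_enorm_noise_add_mix (c : FeedbackCode M K N L) (g : Fin M → Fin K → ℂ)
    (hL : ∀ m, 0 < L m) (B : Matrix (Fin K) (Fin M) ℂ) (i : Fin N) (a : Fin K → ℂ) :
    ∫⁻ p, ‖a ⬝ᵥ (p.2 i + c.mix B p.1 i (c.past g p.1 p.2 i))‖ₑ ^ 2 ∂jointLaw K N L =
      ENNReal.ofReal (sqLength a) +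
        ∫⁻ p, ‖a ⬝ᵥ c.mix B p.1 i (c.past g p.1 p.2 i)‖ₑ ^ 2 ∂jointLaw K N L := by
  have : ∀ m, Nonempty (Fin (L m)) := fun m => ⟨⟨0, hL m⟩⟩
  have : ∀ m, IsProbabilityMeasure (uniformOn (Set.univ : Set (Fin (L m)))) := fun m =>
    isProbabilityMeasure_uniformOn Set.finite_univ Set.univ_nonempty
  have ha : Measurable fun v : Fin K → ℂ => a ⬝ᵥ v := by unfold dotProduct; fun_prop
  have h2 : Measurable fun p : ((m : Fin M) → Fin (L m)) × (Fin N → Fin K → ℂ) => p.2 i :=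
    (measurable_pi_apply i).comp measurable_snd
  have hΦ := (MeasurePreserving.id (Measure.pi fun m : Fin M =>
    uniformOn (Set.univ : Set (Fin (L m))))).prod
      (measurePreserving_flip (measurePreserving_neg_noiseLaw K) i)
  simp_rw [dotProduct_add]
  refine (lintegral_sq_enorm_add_of_flip (μ := jointLaw K N L) hΦ
    (u := fun p => a ⬝ᵥ p.2 i) (v := fun p => a ⬝ᵥ c.mix B p.1 i (c.past g p.1 p.2 i))
    (ha.comp h2) (ha.comp (c.measurable_mix_past g B i)) ?_ ?_).trans ?_
  · intro p
    simp
  · rintro ⟨w, z⟩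
    have h : c.past g w (fun j => if j = i then -z j else z j) i = c.past g w z i :=
      causalPast_congr i fun j hj p => by simp only [if_neg hj.ne]
    simp only [Prod.map, id_eq]
    rw [h]
  · rw [lintegral_comp_noise hL i (f := fun z => ‖a ⬝ᵥ z‖ₑ ^ 2) (by fun_prop),
      lintegral_sq_enorm_dotProduct_noiseLaw]

/-- The quadratic terms cancel in the mean: the whitened residuals have total second moment at most
`N K` by the trace identity, and the noises have exactly `N K`. Only the determinant term remains.
-/
lemma integral_logRatio_le (c : FeedbackCode M K N L) (g : Fin M → Fin K → ℂ)
    (hL : ∀ m, 0 < L m) (B : Matrix (Fin K) (Fin M) ℂ) {A V : Matrix (Fin K) (Fin K) ℂ}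
    (hA : A.det ≠ 0) (hAV : A * A.conjTranspose = 1 + V) (hV : V.PosSemidef)
    (hB : ∀ a : Fin K → ℂ,
      ∑ i, ∫⁻ p, ‖a ⬝ᵥ c.mix B p.1 i (c.past g p.1 p.2 i)‖ₑ ^ 2 ∂jointLaw K N L ≤
        ENNReal.ofReal (N * (a ⬝ᵥ V.mulVec (star a)).re)) :
    Integrable (c.logRatio g B A) (jointLaw K N L) ∧
      ∫ p, c.logRatio g B A p ∂jointLaw K N L ≤ N * Real.log (‖A.det‖ ^ 2) := by
  have := isProbabilityMeasure_jointLaw K N hL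
  have h2 : ∀ i, Measurable fun p : ((m : Fin M) → Fin (L m)) × (Fin N → Fin K → ℂ) => p.2 i :=
    fun i => (measurable_pi_apply i).comp measurable_snd
  let u : Fin N → ((m : Fin M) → Fin (L m)) × (Fin N → Fin K → ℂ) → ℝ := fun i p =>
    sqLength (A⁻¹.mulVec (p.2 i + c.mix B p.1 i (c.past g p.1 p.2 i)))
  let v : Fin N → ((m : Fin M) → Fin (L m)) × (Fin N → Fin K → ℂ) → ℝ := fun i p =>
    sqLength (p.2 i)
  have hum : ∀ i, Measurable (u i) := fun i =>
    measurable_sqLength.comp ((measurable_mulVec A⁻¹).comp ((h2 i).add (c.measurable_mix_past g B i)))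
  have hvm : ∀ i, Measurable (v i) := fun i => measurable_sqLength.comp (h2 i)
  have hVnonneg : ∀ a : Fin K → ℂ, 0 ≤ (a ⬝ᵥ V.mulVec (star a)).re := fun a => by
    have h := hV.dotProduct_mulVec_nonneg (star a)
    rw [star_star] at h
    exact (Complex.le_def.mp h).1
  have hrow : ∀ a : Fin K → ℂ, Measurable fun v : Fin K → ℂ => a ⬝ᵥ v := fun a => by
    unfold dotProduct
    fun_prop
  have hu : ∑ i, ∫⁻ p, ENNReal.ofReal (u i p) ∂jointLaw K N L ≤ ENNReal.ofReal (N * K) := by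
    have h : ∀ i, ∫⁻ p, ENNReal.ofReal (u i p) ∂jointLaw K N L =
        ∑ j, (ENNReal.ofReal (sqLength (A⁻¹ j)) +
          ∫⁻ p, ‖A⁻¹ j ⬝ᵥ c.mix B p.1 i (c.past g p.1 p.2 i)‖ₑ ^ 2 ∂jointLaw K N L) := fun i => by
      simp only [u]
      simp_rw [ofReal_sqLength_mulVec, ← c.lintegral_sq_enorm_noise_add_mix g hL B i]
      rw [lintegral_finsetSum]
      intro j _
      exact (((hrow _).comp ((h2 i).add (c.measurable_mix_past g B i))).enorm).pow_const 2
    simp_rw [h]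
    rw [Finset.sum_comm]
    simp_rw [Finset.sum_add_distrib (s := (Finset.univ : Finset (Fin N)))]
    calc _ ≤ ∑ j, (∑ _ : Fin N, ENNReal.ofReal (sqLength (A⁻¹ j)) +
          ENNReal.ofReal (N * (A⁻¹ j ⬝ᵥ V.mulVec (star (A⁻¹ j))).re)) := by
          gcongr with j
          exact hB _
      _ = ∑ j, ENNReal.ofReal
          (N * (sqLength (A⁻¹ j) + (A⁻¹ j ⬝ᵥ V.mulVec (star (A⁻¹ j))).re)) := by
          refine Finset.sum_congr rfl fun j _ => ?_
          rw [mul_add, ENNReal.ofReal_add (mul_nonneg (Nat.cast_nonneg _) (sqLength_nonneg _))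
            (mul_nonneg (Nat.cast_nonneg _) (hVnonneg _)), Finset.sum_const, Finset.card_univ,
            Fintype.card_fin, nsmul_eq_mul, ENNReal.ofReal_mul (Nat.cast_nonneg _),
            ENNReal.ofReal_mul (Nat.cast_nonneg _), ENNReal.ofReal_natCast]
      _ = ENNReal.ofReal (N * K) := by
          refine (ENNReal.ofReal_sum_of_nonneg fun j _ => mul_nonneg (Nat.cast_nonneg _)
            (add_nonneg (sqLength_nonneg _) (hVnonneg _))).symm.trans ?_
          rw [← Finset.mul_sum, sum_sqLength_add_re_rows hA hAV]
  have hv : ∀ i, ∫⁻ p, ENNReal.ofReal (v i p) ∂jointLaw K N L = ENNReal.ofReal K := fun i => by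
    simp only [v]
    rw [lintegral_comp_noise hL i (f := fun z => ENNReal.ofReal (sqLength z)) (by fun_prop)]
    have h : ∀ z : Fin K → ℂ, ENNReal.ofReal (sqLength z) = ∑ k, ‖z k‖ₑ ^ 2 := fun z => by
      simp_rw [sqLength, ENNReal.ofReal_sum_of_nonneg fun _ _ => sq_nonneg _,
        ENNReal.ofReal_pow (norm_nonneg _), ofReal_norm]
    simp_rw [h]
    rw [lintegral_finsetSum _ fun k _ => by fun_prop]
    simp_rw [fun k : Fin K => (measurePreserving_eval (fun _ : Fin K => stdComplexGaussian)
      k).lintegral_comp (f := fun z => ‖z‖ₑ ^ 2) (by fun_prop),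
      lintegral_sq_enorm_stdComplexGaussian]
    simp
  have hint : ∀ {f : ((m : Fin M) → Fin (L m)) × (Fin N → Fin K → ℂ) → ℝ} (_ : Measurable f)
      (_ : ∀ p, 0 ≤ f p) (_ : ∫⁻ p, ENNReal.ofReal (f p) ∂jointLaw K N L ≠ ∞),
      Integrable f (jointLaw K N L) := fun hf h0 h => by
    refine ⟨hf.aestronglyMeasurable, ?_⟩
    rw [hasFiniteIntegral_iff_ofReal (ae_of_all _ h0)]
    exact h.lt_top
  have hui : ∀ i, Integrable (u i) (jointLaw K N L) := fun i =>
    hint (hum i) (fun _ => sqLength_nonneg _)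
      (((Finset.single_le_sum (fun _ _ => zero_le) (Finset.mem_univ i)).trans hu).trans_lt
        ENNReal.ofReal_lt_top).ne
  have hvi : ∀ i, Integrable (v i) (jointLaw K N L) := fun i =>
    hint (hvm i) (fun _ => sqLength_nonneg _) (by rw [hv]; exact ENNReal.ofReal_ne_top)
  have hu' : ∑ i, ∫ p, u i p ∂jointLaw K N L ≤ N * K := by
    have h : ∀ i, ∫⁻ p, ENNReal.ofReal (u i p) ∂jointLaw K N L =
        ENNReal.ofReal (∫ p, u i p ∂jointLaw K N L) := fun i =>
      (ofReal_integral_eq_lintegral_ofReal (hui i) (ae_of_all _ fun _ => sqLength_nonneg _)).symm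
    simp_rw [h] at hu
    rw [← ENNReal.ofReal_sum_of_nonneg fun i _ => integral_nonneg fun _ => sqLength_nonneg _] at hu
    exact (ENNReal.ofReal_le_ofReal_iff (by positivity)).mp hu
  have hv' : ∀ i, ∫ p, v i p ∂jointLaw K N L = K := fun i => by
    rw [integral_eq_lintegral_of_nonneg_ae (ae_of_all _ fun _ => sqLength_nonneg _)
      (hvm i).aestronglyMeasurable, hv, ENNReal.toReal_ofReal (Nat.cast_nonneg _)]
  have hti : ∀ i, Integrable (fun p => Real.log (‖A.det‖ ^ 2) + u i p - v i p) (jointLaw K N L) :=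
    fun i => ((integrable_const _).add (hui i)).sub (hvi i)
  refine ⟨integrable_finsetSum _ fun i _ => hti i, ?_⟩
  have h : ∫ p, c.logRatio g B A p ∂jointLaw K N L =
      ∑ i, ∫ p, (Real.log (‖A.det‖ ^ 2) + u i p - v i p) ∂jointLaw K N L :=
    integral_finsetSum _ fun i _ => hti i
  have h' : ∀ i, ∫ p, (Real.log (‖A.det‖ ^ 2) + u i p - v i p) ∂jointLaw K N L =
      Real.log (‖A.det‖ ^ 2) + ∫ p, u i p ∂jointLaw K N L - K := fun i => by
    have hc : Integrable (fun _ => Real.log (‖A.det‖ ^ 2)) (jointLaw K N L) := integrable_const _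
    rw [integral_sub (f := fun p => Real.log (‖A.det‖ ^ 2) + u i p) (hc.add (hui i)) (hvi i), hv',
      integral_add hc (hui i)]
    simp
  rw [h]
  simp_rw [h']
  rw [Finset.sum_sub_distrib, Finset.sum_add_distrib]
  simp only [Finset.sum_const, Finset.card_univ, Fintype.card_fin, nsmul_eq_mul]
  linarith

/-- The weak converse for the messages of the transmitters in `S`, by comparison with a Gaussian
channel in which the output at receiver `k` does not depend on these messages. -/
theorem log_card_messages_le (c : FeedbackCode M K N L) (g : Fin M → Fin K → ℂ)
    (hL : ∀ m, 0 < L m) (B : Matrix (Fin K) (Fin M) ℂ) {V : Matrix (Fin K) (Fin K) ℂ}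
    (hV : V.PosSemidef)
    (hB : ∀ a : Fin K → ℂ,
      ∑ i, ∫⁻ p, ‖a ⬝ᵥ c.mix B p.1 i (c.past g p.1 p.2 i)‖ₑ ^ 2 ∂jointLaw K N L ≤
        ENNReal.ofReal (N * (a ⬝ᵥ V.mulVec (star a)).re))
    (S : Finset (Fin M)) (k : Fin K)
    (hS : ∀ A w w' z i, (∀ m ∉ S, w m = w' m) →
      causalRun (c.step (gains g - B) A w) z i k = causalRun (c.step (gains g - B) A w') z i k) :
    (1 - (c.errorProb g k).toReal) * ∑ m ∈ S, Real.log (L m) ≤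
      1 + N * Real.log (1 + V).det.re := by
  have := isProbabilityMeasure_jointLaw K N hL
  obtain ⟨A, hA, hAV⟩ := exists_mul_conjTranspose_eq_one_add hV
  have hdet : (1 + V).det.re = ‖A.det‖ ^ 2 := by
    rw [← hAV, Matrix.det_mul, Matrix.det_conjTranspose, RCLike.star_def, Complex.mul_conj,
      Complex.ofReal_re, Complex.sq_norm]
  have hdec : Measurable fun y : Fin N → Fin K → ℂ => c.dec k fun i => y i k :=
    (c.measurable_dec k).comp (by fun_prop)
  have hset : MeasurableSet {p : ((m : Fin M) → Fin (L m)) × (Fin N → Fin K → ℂ) |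
      c.dec k (fun i => c.output g p.1 p.2 i k) = p.1} :=
    measurableSet_eq_fun (hdec.comp (c.measurable_output g)) measurable_fst
  obtain ⟨hTi, hT⟩ := c.integral_logRatio_le g hL B hA hAV hV hB
  have h := measureReal_mul_log_le (c.measurable_logRatio g B A) hTi hset
    (q := ∏ m ∈ S, (L m : ℝ)) (Finset.prod_pos fun m _ => by exact_mod_cast hL m)
    (c.lintegral_exp_neg_logRatio_jointLaw g hL B hA).le
    (c.setLIntegral_exp_neg_logRatio_le g hL B hA S k (hS A))
  have herr : (c.errorProb g k).toReal = 1 - (jointLaw K N L).real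
      {p | c.dec k (fun i => c.output g p.1 p.2 i k) = p.1} := by
    rw [← probReal_compl_eq_one_sub hset]
    rfl
  rw [Real.log_prod fun m _ => by exact_mod_cast (hL m).ne'] at h
  rw [herr, hdet, sub_sub_cancel]
  linarith

end FeedbackCode

/-! ### The input covariance and the bounds at finite block length. -/

namespace FeedbackCode

variable {M K N : ℕ} {L : Fin M → ℕ}

lemma memLp_input (c : FeedbackCode M K N L) {g : Fin M → Fin K → ℂ} (hc : c.PowerConstraint g)
    (m : Fin M) (i : Fin N) :
    MemLp (fun p : ((m : Fin M) → Fin (L m)) × (Fin N → Fin K → ℂ) => c.input g p.1 p.2 m i) 2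
      (jointLaw K N L) := by
  have hm := c.measurable_input g m i
  rw [memLp_two_iff_integrable_sq_norm hm.aestronglyMeasurable]
  refine ⟨(hm.norm.pow_const 2).aestronglyMeasurable, ?_⟩
  rw [hasFiniteIntegral_iff_ofReal (ae_of_all _ fun _ => sq_nonneg _)]
  simp_rw [ENNReal.ofReal_pow (norm_nonneg _), ofReal_norm]
  exact ((Finset.single_le_sum (f := fun i => ∫⁻ p, ‖c.input g p.1 p.2 m i‖ₑ ^ 2 ∂jointLaw K N L)
    (fun _ _ => zero_le) (Finset.mem_univ i)).trans (hc m)).trans_lt (ENNReal.natCast_lt_top N)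

/-- The time average of the second moments of the inputs. -/
def inputMoment (c : FeedbackCode M K N L) (g : Fin M → Fin K → ℂ) : Matrix (Fin M) (Fin M) ℂ :=
  Matrix.of fun m n => (N : ℂ)⁻¹ *
    ∑ i, ∫ p, c.input g p.1 p.2 m i * star (c.input g p.1 p.2 n i) ∂jointLaw K N L

/-- The quadratic form is the average power of a linear combination of the inputs; positivity and
the diagonal bound are read off from it. -/
lemma dotProduct_inputMoment (c : FeedbackCode M K N L) {g : Fin M → Fin K → ℂ}
    (hc : c.PowerConstraint g) (b : Fin M → ℂ) :
    b ⬝ᵥ (c.inputMoment g).mulVec (star b) =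
      (((N : ℝ)⁻¹ * ∑ i, ∫ p, ‖∑ m, b m * c.input g p.1 p.2 m i‖ ^ 2 ∂jointLaw K N L : ℝ) : ℂ) := by
  have hint : ∀ m n i, Integrable (fun p : ((m : Fin M) → Fin (L m)) × (Fin N → Fin K → ℂ) =>
      c.input g p.1 p.2 m i * star (c.input g p.1 p.2 n i)) (jointLaw K N L) := fun m n i =>
    (c.memLp_input hc m i).integrable_mul (c.memLp_input hc n i).star
  have h : ∀ i, ((∫ p, ‖∑ m, b m * c.input g p.1 p.2 m i‖ ^ 2 ∂jointLaw K N L : ℝ) : ℂ) =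
      ∑ m, ∑ n, b m * star (b n) *
        ∫ p, c.input g p.1 p.2 m i * star (c.input g p.1 p.2 n i) ∂jointLaw K N L := fun i => by
    rw [← integral_complex_ofReal]
    have h' : ∀ p : ((m : Fin M) → Fin (L m)) × (Fin N → Fin K → ℂ),
        ((‖∑ m, b m * c.input g p.1 p.2 m i‖ ^ 2 : ℝ) : ℂ) = ∑ m, ∑ n, b m * star (b n) *
          (c.input g p.1 p.2 m i * star (c.input g p.1 p.2 n i)) := fun p => by
      rw [Complex.sq_norm, ← Complex.mul_conj, map_sum, Finset.sum_mul_sum]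
      refine Finset.sum_congr rfl fun m _ => Finset.sum_congr rfl fun n _ => ?_
      rw [map_mul, RCLike.star_def]
      ring
    simp_rw [h']
    rw [integral_finsetSum _ fun m _ => integrable_finsetSum _ fun n _ => (hint m n i).const_mul _]
    refine Finset.sum_congr rfl fun m _ => ?_
    rw [integral_finsetSum _ fun n _ => (hint m n i).const_mul _]
    exact Finset.sum_congr rfl fun n _ => integral_const_mul _ _
  push_cast
  simp_rw [h]
  rw [Finset.sum_comm, dotProduct, Finset.mul_sum]
  refine Finset.sum_congr rfl fun m _ => ?_
  rw [Finset.sum_comm, Matrix.mulVec, dotProduct, Finset.mul_sum, Finset.mul_sum]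
  refine Finset.sum_congr rfl fun n _ => ?_
  rw [inputMoment, Matrix.of_apply, Pi.star_apply, ← Finset.mul_sum]
  ring

lemma posSemidef_inputMoment (c : FeedbackCode M K N L) {g : Fin M → Fin K → ℂ}
    (hc : c.PowerConstraint g) : (c.inputMoment g).PosSemidef := by
  refine Matrix.PosSemidef.of_dotProduct_mulVec_nonneg ?_ fun x => ?_
  · ext m n
    rw [Matrix.conjTranspose_apply, inputMoment, Matrix.of_apply, Matrix.of_apply, star_mul',
      star_sum]
    congr 1
    · simp
    · refine Finset.sum_congr rfl fun i _ => ?_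
      rw [RCLike.star_def, ← integral_conj]
      refine integral_congr_ae (ae_of_all _ fun p => ?_)
      simp [mul_comm]
  · have h := c.dotProduct_inputMoment hc (star x)
    rw [star_star] at h
    rw [h]
    exact_mod_cast mul_nonneg (by positivity)
      (Finset.sum_nonneg fun i _ => integral_nonneg fun p => by positivity)

lemma inputMoment_diag_le (c : FeedbackCode M K N L) {g : Fin M → Fin K → ℂ}
    (hc : c.PowerConstraint g) (m : Fin M) : c.inputMoment g m m ≤ 1 := by
  have h := c.dotProduct_inputMoment hc (Pi.single m 1)
  rw [← Pi.single_star, star_one, Matrix.mulVec_single_one, single_one_dotProduct] at h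
  rw [show c.inputMoment g m m = (c.inputMoment g).col m m from rfl, h]
  have h' : ∀ (p : ((m : Fin M) → Fin (L m)) × (Fin N → Fin K → ℂ)) i,
      ∑ n, (Pi.single m 1 : Fin M → ℂ) n * c.input g p.1 p.2 n i = c.input g p.1 p.2 m i :=
    fun p i => by simp [Pi.single_apply]
  simp_rw [h']
  have hsum : ∑ i, ∫ p, ‖c.input g p.1 p.2 m i‖ ^ 2 ∂jointLaw K N L ≤ N := by
    have h1 := hc m
    have h2 : ∀ i, ∫⁻ p, ‖c.input g p.1 p.2 m i‖ₑ ^ 2 ∂jointLaw K N L =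
        ENNReal.ofReal (∫ p, ‖c.input g p.1 p.2 m i‖ ^ 2 ∂jointLaw K N L) := fun i => by
      rw [ofReal_integral_eq_lintegral_ofReal
        ((memLp_two_iff_integrable_sq_norm (c.measurable_input g m i).aestronglyMeasurable).mp
          (c.memLp_input hc m i)) (ae_of_all _ fun _ => sq_nonneg _)]
      simp_rw [ENNReal.ofReal_pow (norm_nonneg _), ofReal_norm]
    simp_rw [h2] at h1
    rw [← ENNReal.ofReal_sum_of_nonneg fun i _ => integral_nonneg fun _ => sq_nonneg _,
      ← ENNReal.ofReal_natCast, ENNReal.ofReal_le_ofReal_iff (Nat.cast_nonneg _)] at h1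
    exact h1
  have : (N : ℝ)⁻¹ * ∑ i, ∫ p, ‖c.input g p.1 p.2 m i‖ ^ 2 ∂jointLaw K N L ≤ 1 := by
    -- For `N = 0` the average is `0`, because `0⁻¹ = 0`.
    rcases Nat.eq_zero_or_pos N with rfl | hN
    · simp
    · rw [inv_mul_le_iff₀ (by positivity)]
      linarith
  exact_mod_cast this

/-- A covariance matrix of unit powers that dominates the average second moments of the inputs. -/
lemma exists_unit_power_covariance (c : FeedbackCode M K N L) {g : Fin M → Fin K → ℂ}
    (hN : 0 < N) (hc : c.PowerConstraint g) :
    ∃ Q : Matrix (Fin M) (Fin M) ℂ, Q.PosSemidef ∧ (∀ m, Q m m = 1) ∧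
      ∀ b : Fin M → ℂ,
        ∑ i, ∫⁻ p, ‖∑ m, b m * c.input g p.1 p.2 m i‖ₑ ^ 2 ∂jointLaw K N L ≤
          ENNReal.ofReal (N * (b ⬝ᵥ Q.mulVec (star b)).re) := by
  -- Unused power is filled by a nonnegative diagonal matrix, as if independent signals were added;
  -- this can only increase the quadratic form.
  have hD : (Matrix.diagonal fun m => 1 - c.inputMoment g m m).PosSemidef :=
    Matrix.PosSemidef.diagonal fun m => sub_nonneg.mpr (c.inputMoment_diag_le hc m)
  refine ⟨c.inputMoment g + Matrix.diagonal fun m => 1 - c.inputMoment g m m,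
    (c.posSemidef_inputMoment hc).add hD, fun m => by simp, fun b => ?_⟩
  have h0 : 0 ≤ (b ⬝ᵥ (Matrix.diagonal fun m => 1 - c.inputMoment g m m).mulVec (star b)).re := by
    have h := hD.dotProduct_mulVec_nonneg (star b)
    rw [star_star] at h
    exact (Complex.le_def.mp h).1
  have hint : ∀ i, Integrable (fun p : ((m : Fin M) → Fin (L m)) × (Fin N → Fin K → ℂ) =>
      ‖∑ m, b m * c.input g p.1 p.2 m i‖ ^ 2) (jointLaw K N L) := fun i => by
    refine (memLp_two_iff_integrable_sq_norm ?_).mp ?_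
    · exact (Finset.measurable_sum _ fun m _ =>
        (c.measurable_input g m i).const_mul (b m)).aestronglyMeasurable
    · exact memLp_finsetSum _ fun m _ => (c.memLp_input hc m i).const_mul (b m)
  have h1 : ∀ i, ∫⁻ p, ‖∑ m, b m * c.input g p.1 p.2 m i‖ₑ ^ 2 ∂jointLaw K N L =
      ENNReal.ofReal (∫ p, ‖∑ m, b m * c.input g p.1 p.2 m i‖ ^ 2 ∂jointLaw K N L) := fun i => by
    rw [ofReal_integral_eq_lintegral_ofReal (hint i) (ae_of_all _ fun _ => sq_nonneg _)]
    simp_rw [ENNReal.ofReal_pow (norm_nonneg _), ofReal_norm]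
  simp_rw [h1]
  rw [← ENNReal.ofReal_sum_of_nonneg fun i _ => integral_nonneg fun _ => sq_nonneg _]
  refine ENNReal.ofReal_le_ofReal ?_
  rw [Matrix.add_mulVec, dotProduct_add, Complex.add_re, c.dotProduct_inputMoment hc b,
    Complex.ofReal_re, mul_add, ← mul_assoc, mul_inv_cancel₀ (by positivity), one_mul]
  exact le_add_of_nonneg_right (mul_nonneg (Nat.cast_nonneg _) h0)

/-- The cut-set bounds at finite block length, for one input covariance matrix. -/
theorem exists_covariance_bounds (c : FeedbackCode M K N L) {g : Fin M → Fin K → ℂ}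
    (hL : ∀ m, 0 < L m) (hN : 0 < N) (hc : c.PowerConstraint g) :
    ∃ Q : Matrix (Fin M) (Fin M) ℂ, Q.PosSemidef ∧ (∀ m, Q m m = 1) ∧
      (∀ (S : Finset (Fin M)) (k : Fin K) (B : Matrix (Fin K) (Fin M) ℂ),
        (∀ j, ∀ m ∈ S, B j m = g m j) →
        (1 - (c.errorProb g k).toReal) * ∑ m ∈ S, Real.log (L m) ≤
          1 + N * Real.log (1 + B * Q * B.conjTranspose).det.re) ∧
      ∀ k : Fin K, (1 - (c.errorProb g k).toReal) * ∑ m, Real.log (L m) ≤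
        1 + N * Real.log (1 + (∑ m, ∑ n, g m k * Q m n * star (g n k)).re) := by
  obtain ⟨Q, hQ, hQ1, hb⟩ := c.exists_unit_power_covariance hN hc
  have hB : ∀ (B : Matrix (Fin K) (Fin M) ℂ) (a : Fin K → ℂ),
      ∑ i, ∫⁻ p, ‖a ⬝ᵥ c.mix B p.1 i (c.past g p.1 p.2 i)‖ₑ ^ 2 ∂jointLaw K N L ≤
        ENNReal.ofReal (N * (a ⬝ᵥ (B * Q * B.conjTranspose).mulVec (star a)).re) := fun B a => by
    have h := hb (Matrix.vecMul a B)
    rw [Matrix.star_vecMul, Matrix.mulVec_mulVec, ← Matrix.dotProduct_mulVec,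
      Matrix.mulVec_mulVec, ← Matrix.mul_assoc] at h
    refine le_trans (le_of_eq ?_) h
    refine Finset.sum_congr rfl fun i _ => lintegral_congr fun p => ?_
    rw [mix, Matrix.dotProduct_mulVec]
    simp_rw [input_eq]
    rfl
  have hV : ∀ B : Matrix (Fin K) (Fin M) ℂ, (B * Q * B.conjTranspose).PosSemidef := fun B =>
    hQ.mul_mul_conjTranspose_same B
  refine ⟨Q, hQ, hQ1, fun S k B hBS => ?_, fun k => ?_⟩
  -- The columns of `gains g - B` in `S` vanish, so no auxiliary output at any receiver depends on
  -- the messages in `S`.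
  · refine c.log_card_messages_le g hL B (hV B) (hB B) S k fun A w w' z i hw => ?_
    refine congrFun (causalRun_congr i fun j _ p => ?_) k
    rw [step, step]
    congr 1
    funext l
    simp only [mix, Matrix.mulVec, dotProduct]
    refine Finset.sum_congr rfl fun m _ => ?_
    by_cases hm : m ∈ S
    · simp [hBS l m hm]
    · rw [hw m hm]
  -- Row `k` of `gains g - B` vanishes, so receiver `k` sees only noise, even though the outputs at
  -- the other receivers may still depend on the messages. The matrix `1 + B Q Bᴴ` is diagonal with
  -- one nontrivial entry.
  · let B : Matrix (Fin K) (Fin M) ℂ := Matrix.of fun j m => if j = k then g m k else 0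
    have hdet : (1 + B * Q * B.conjTranspose).det = 1 + ∑ m, ∑ n, g m k * Q m n * star (g n k) := by
      have h : 1 + B * Q * B.conjTranspose = Matrix.diagonal fun j =>
          if j = k then 1 + ∑ m, ∑ n, g m k * Q m n * star (g n k) else 1 := by
        ext j l
        rw [Matrix.add_apply, Matrix.mul_apply]
        simp_rw [Matrix.mul_apply, Matrix.conjTranspose_apply, B, Matrix.of_apply]
        by_cases hjl : j = l
        · subst hjl
          by_cases hj : j = k
          · simp only [hj, if_true, Matrix.one_apply_eq, Matrix.diagonal_apply_eq]
            congr 1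
            rw [Finset.sum_comm]
            exact Finset.sum_congr rfl fun m _ => Finset.sum_mul _ _ _
          · simp [hj]
        · by_cases hj : j = k
          · have hl : l ≠ k := fun h => hjl (hj.trans h.symm)
            simp [hjl, hl]
          · simp [hjl, hj]
      rw [h, Matrix.det_diagonal, Finset.prod_ite_eq' Finset.univ k, if_pos (Finset.mem_univ k)]
    have h := c.log_card_messages_le g hL B (hV B) (hB B) Finset.univ k fun A w w' z i _ => by
      have hz : ∀ w, causalRun (c.step (gains g - B) A w) z i k = A.mulVec (z i) k := fun w => by
        rw [causalRun_eq, step, Pi.add_apply, mix, Matrix.mulVec, dotProduct]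
        simp [B]
      rw [hz, hz]
    rwa [hdet, Complex.add_re, Complex.one_re] at h

end FeedbackCode

/-! ### The pseudoinverse and the conditional covariance. -/

/-- The spectrum is finite, so the functional calculus applies to `x⁻¹` in spite of its
discontinuity at `0`. -/
lemma continuousOn_spectrum {n : Type*} [Fintype n] [DecidableEq n] (A : Matrix n n ℂ)
    (f : ℝ → ℝ) : ContinuousOn f (spectrum ℝ A) :=
  (Matrix.finite_real_spectrum (A := A)).continuousOn f

lemma pinv_isHermitian {n : Type*} [Fintype n] [DecidableEq n] (A : Matrix n n ℂ) :
    (pinv A).IsHermitian :=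
  cfc_predicate (p := IsSelfAdjoint) (fun x : ℝ => x⁻¹) A

lemma pinv_mul_self_mul_pinv {n : Type*} [Fintype n] [DecidableEq n] {A : Matrix n n ℂ}
    (hA : A.IsHermitian) : pinv A * A * pinv A = pinv A := by
  have hA' : IsSelfAdjoint A := hA
  have hid : cfc (fun x : ℝ => x) A = A := cfc_id' ℝ A
  have h1 : pinv A * A = cfc (fun x : ℝ => x⁻¹ * x) A := by
    rw [cfc_mul (fun x : ℝ => x⁻¹) (fun x => x) A (continuousOn_spectrum A _)
      (continuousOn_spectrum A _), hid, pinv]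
  rw [h1, pinv, ← cfc_mul _ _ A (continuousOn_spectrum A _) (continuousOn_spectrum A _)]
  congr 1
  funext x
  by_cases hx : x = 0
  · simp [hx]
  · rw [inv_mul_cancel₀ hx, one_mul]

/-- The conditional covariance matrix is the covariance matrix of the error of a linear estimate of
`X_S` from `X_{Sᶜ}`. -/
lemma exists_condCov_eq {M : ℕ} {Q : Matrix (Fin M) (Fin M) ℂ} (hQ : Q.IsHermitian)
    (S : Finset (Fin M)) :
    ∃ C : Matrix {m // m ∈ S} (Fin M) ℂ, (∀ s, ∀ m (h : m ∈ S), C s m =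
      (1 : Matrix {m // m ∈ S} {m // m ∈ S} ℂ) s ⟨m, h⟩) ∧
      C * Q * C.conjTranspose = condCov Q S := by
  let e : {m // m ∈ S} ⊕ {m // m ∉ S} ≃ Fin M := Equiv.sumCompl (· ∈ S)
  let b := Q.toBlock (· ∈ S) (· ∉ S)
  let d := Q.toBlock (· ∉ S) (· ∉ S)
  have hd : d.IsHermitian := hQ.submatrix _
  have hb : b.conjTranspose = Q.toBlock (· ∉ S) (· ∈ S) := by
    ext i j
    exact hQ.apply _ _
  -- `C X = X_S - b d⁺ X_{Sᶜ}` is the error of the linear estimate.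
  let C : Matrix {m // m ∈ S} (Fin M) ℂ :=
    (Matrix.fromCols 1 (-(b * pinv d))).submatrix id e.symm
  refine ⟨C, fun s m h => ?_, ?_⟩
  · have hm : e.symm m = Sum.inl ⟨m, h⟩ := e.symm_apply_eq.mpr rfl
    simp only [C, Matrix.submatrix_apply, id_eq, hm, Matrix.fromCols_apply_inl]
  · have hQe : Q = (Matrix.fromBlocks (Q.toBlock (· ∈ S) (· ∈ S)) b b.conjTranspose d).submatrix
        e.symm e.symm := by
      rw [hb]
      ext i j
      obtain ⟨i, rfl⟩ := e.surjective i
      obtain ⟨j, rfl⟩ := e.surjective j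
      rcases i with i | i <;> rcases j with j | j <;> simp <;> rfl
    have hP : (pinv d).conjTranspose = pinv d := pinv_isHermitian d
    conv_lhs => rw [hQe]
    simp only [C]
    rw [Matrix.conjTranspose_submatrix, Matrix.submatrix_mul_equiv, Matrix.submatrix_mul_equiv,
      Matrix.submatrix_id_id, Matrix.conjTranspose_fromCols_eq_fromRows_conjTranspose,
      Matrix.fromCols_mul_fromBlocks, Matrix.fromCols_mul_fromRows, condCov, ← hb,
      Matrix.conjTranspose_neg, Matrix.conjTranspose_mul, Matrix.conjTranspose_one, hP]
    -- The error is uncorrelated with the estimate. The identity `d⁺ d d⁺ = d⁺` suffices for this,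
    -- so the range of `b` plays no role.
    have h0 : (b + -(b * pinv d) * d) * -(pinv d * b.conjTranspose) = 0 := by
      rw [Matrix.add_mul, Matrix.neg_mul, Matrix.neg_mul, Matrix.mul_neg, Matrix.mul_neg, neg_neg,
        show b * pinv d * d * (pinv d * b.conjTranspose) =
          b * (pinv d * d * pinv d) * b.conjTranspose by simp only [Matrix.mul_assoc],
        pinv_mul_self_mul_pinv hd, Matrix.mul_assoc, neg_add_cancel]
    rw [Matrix.one_mul, Matrix.one_mul, Matrix.mul_one, h0, add_zero, Matrix.neg_mul,
      ← sub_eq_add_neg]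

/-- `B = G_S C` is admissible for the cut `S` because `C` is the identity on the columns in `S`. -/
lemma exists_gain_mul_condCov_eq {M K : ℕ} (g : Fin M → Fin K → ℂ)
    {Q : Matrix (Fin M) (Fin M) ℂ} (hQ : Q.IsHermitian) (S : Finset (Fin M)) :
    ∃ B : Matrix (Fin K) (Fin M) ℂ, (∀ j, ∀ m ∈ S, B j m = g m j) ∧
      B * Q * B.conjTranspose =
        gainMatrix g S * condCov Q S * (gainMatrix g S).conjTranspose := by
  obtain ⟨C, hC, hCQ⟩ := exists_condCov_eq hQ S
  refine ⟨gainMatrix g S * C, fun j m hm => ?_, ?_⟩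
  · rw [Matrix.mul_apply]
    simp_rw [hC _ m hm]
    rw [← Matrix.mul_apply, Matrix.mul_one]
    rfl
  · rw [← hCQ, Matrix.conjTranspose_mul]
    simp only [Matrix.mul_assoc]

/-! ### Compactness and the limit of long blocks. -/

/-- The principal `2 × 2` minor on the indices `m`, `n` is nonnegative. -/
lemma norm_apply_le_one {M : ℕ} {Q : Matrix (Fin M) (Fin M) ℂ} (hQ : Q.PosSemidef)
    (h1 : ∀ m, Q m m = 1) (m n : Fin M) : ‖Q m n‖ ≤ 1 := by
  have h := (hQ.submatrix ![m, n]).det_nonneg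
  rw [Matrix.det_fin_two] at h
  simp only [Matrix.submatrix_apply, Matrix.cons_val_zero, Matrix.cons_val_one, h1, mul_one] at h
  rw [← hQ.isHermitian.apply n m, RCLike.star_def, Complex.mul_conj] at h
  have h' : (0 : ℝ) ≤ 1 - Complex.normSq (Q m n) := by exact_mod_cast h
  rw [← Complex.sq_norm] at h'
  nlinarith [norm_nonneg (Q m n)]

/-- The covariance matrices of unit powers for which the cut-set bounds hold up to `δ`. -/
def boundSet {M K : ℕ} (g : Fin M → Fin K → ℂ) (R : Fin M → ℝ) (δ : ℝ) :
    Set (Matrix (Fin M) (Fin M) ℂ) :=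
  {Q | Q.PosSemidef ∧ (∀ m, Q m m = 1) ∧
    (∀ (S : Finset (Fin M)) (B : Matrix (Fin K) (Fin M) ℂ), (∀ j, ∀ m ∈ S, B j m = g m j) →
      (2 : ℝ) ^ (∑ m ∈ S, R m - δ) ≤ (1 + B * Q * B.conjTranspose).det.re) ∧
    ∀ k : Fin K, (2 : ℝ) ^ (∑ m, R m - δ) ≤
      1 + (∑ m, ∑ n, g m k * Q m n * star (g n k)).re}

lemma boundSet_subset {M K : ℕ} {g : Fin M → Fin K → ℂ} {R R' : Fin M → ℝ} {δ δ' : ℝ}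
    (h : ∀ S : Finset (Fin M), ∑ m ∈ S, R m - δ ≤ ∑ m ∈ S, R' m - δ') :
    boundSet g R' δ' ⊆ boundSet g R δ := fun _ hQ =>
  ⟨hQ.1, hQ.2.1,
    fun S B hB => (Real.rpow_le_rpow_of_exponent_le one_le_two (h S)).trans (hQ.2.2.1 S B hB),
    fun k => (Real.rpow_le_rpow_of_exponent_le one_le_two (h Finset.univ)).trans (hQ.2.2.2 k)⟩

lemma isClosed_posSemidef (n : Type*) [Fintype n] :
    IsClosed {Q : Matrix n n ℂ | Q.PosSemidef} := by
  have h : {Q : Matrix n n ℂ | Q.PosSemidef} =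
      {Q | Q.conjTranspose = Q} ∩ ⋂ x : n → ℂ, {Q | 0 ≤ star x ⬝ᵥ Q.mulVec x} := by
    ext Q
    simp [Matrix.posSemidef_iff_dotProduct_mulVec, Matrix.IsHermitian]
  rw [h]
  refine (isClosed_eq (by fun_prop) continuous_id).inter (isClosed_iInter fun x => ?_)
  exact isClosed_le continuous_const (by fun_prop)

/-- For each fixed `B` the bound is a closed condition, polynomial in the entries of `Q`, and the
set is an intersection over all admissible `B`. A definition through `condCov` would involve the
discontinuous pseudoinverse. -/
lemma isClosed_boundSet {M K : ℕ} (g : Fin M → Fin K → ℂ) (R : Fin M → ℝ) (δ : ℝ) :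
    IsClosed (boundSet g R δ) := by
  have hentry : ∀ m n, Continuous fun Q : Matrix (Fin M) (Fin M) ℂ => Q m n := fun m n =>
    continuous_id.matrix_elem m n
  simp only [boundSet, Set.ofPred_and, Set.ofPred_forall]
  refine (isClosed_posSemidef _).inter ((isClosed_iInter fun m => ?_).inter
    ((isClosed_iInter fun S => isClosed_iInter fun B => isClosed_iInter fun _ => ?_).inter
      (isClosed_iInter fun k => ?_)))
  · exact isClosed_eq (hentry m m) continuous_const
  · refine isClosed_le continuous_const (Complex.continuous_re.comp (Continuous.matrix_det ?_))
    fun_prop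
  · refine isClosed_le continuous_const (continuous_const.add (Complex.continuous_re.comp ?_))
    refine continuous_finsetSum _ fun m _ => continuous_finsetSum _ fun n _ => ?_
    exact (continuous_const.mul (hentry m n)).mul continuous_const

lemma isCompact_boundSet {M K : ℕ} (g : Fin M → Fin K → ℂ) (R : Fin M → ℝ) (δ : ℝ) :
    IsCompact (boundSet g R δ) := by
  have hc : IsCompact (Set.univ.pi fun _ : Fin M => Set.univ.pi fun _ : Fin M =>
      Metric.closedBall (0 : ℂ) 1) :=
    isCompact_univ_pi fun _ => isCompact_univ_pi fun _ => isCompact_closedBall 0 1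
  refine hc.of_isClosed_subset (isClosed_boundSet g R δ) fun Q hQ m _ n _ => ?_
  rw [mem_closedBall_zero_iff]
  exact norm_apply_le_one hQ.1 hQ.2.1 m n

lemma numMessages_pos (N : ℕ) {R : ℝ} (hR : 0 ≤ R) : 0 < numMessages N R :=
  Nat.floor_pos.mpr (Real.one_le_rpow one_le_two (by positivity))

lemma le_log_numMessages (N : ℕ) {R : ℝ} (hR : 0 ≤ R) :
    (N * R - 1) * Real.log 2 ≤ Real.log (numMessages N R) := by
  have hpos := numMessages_pos N hR
  have h1 : (1 : ℝ) ≤ numMessages N R := by exact_mod_cast hpos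
  have h2 : (2 : ℝ) ^ ((N : ℝ) * R) < numMessages N R + 1 := Nat.lt_floor_add_one _
  rw [← Real.log_rpow two_pos]
  refine Real.log_le_log (by positivity) ?_
  rw [Real.rpow_sub two_pos, Real.rpow_one]
  linarith

lemma re_quadratic_nonneg {M : ℕ} {Q : Matrix (Fin M) (Fin M) ℂ} (hQ : Q.PosSemidef)
    (b : Fin M → ℂ) : 0 ≤ (∑ m, ∑ n, b m * Q m n * star (b n)).re := by
  have h := hQ.dotProduct_mulVec_nonneg (star b)
  rw [star_star] at h
  have h' : b ⬝ᵥ Q.mulVec (star b) = ∑ m, ∑ n, b m * Q m n * star (b n) := by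
    simp only [dotProduct, Matrix.mulVec, Finset.mul_sum, Pi.star_apply, mul_assoc]
  rw [h'] at h
  exact (Complex.le_def.mp h).1

lemma det_one_add_re_pos {M K : ℕ} {Q : Matrix (Fin M) (Fin M) ℂ} (hQ : Q.PosSemidef)
    (B : Matrix (Fin K) (Fin M) ℂ) : 0 < (1 + B * Q * B.conjTranspose).det.re :=
  (Complex.lt_def.mp
    (Matrix.PosDef.one.add_posSemidef (hQ.mul_mul_conjTranspose_same B)).det_pos).1

lemma Achievable.boundSet_nonempty {M K : ℕ} (hK : 0 < K) {g : Fin M → Fin K → ℂ}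
    {R : Fin M → ℝ} (hR : Achievable g R) {δ : ℝ} (hδ : 0 < δ) : (boundSet g R δ).Nonempty := by
  obtain ⟨hR0, c, hP, herr⟩ := hR
  have hlog : 0 < Real.log 2 := Real.log_pos one_lt_two
  have hinv : Tendsto (fun N : ℕ => ((N : ℝ))⁻¹) atTop (𝓝 0) := tendsto_inv_atTop_nhds_zero_nat
  have herr' : ∀ k, Tendsto (fun N => ((c N).errorProb g k).toReal) atTop (𝓝 0) := fun k => by
    simpa [Function.comp_def] using (ENNReal.tendsto_toReal ENNReal.zero_ne_top).comp (herr k)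
  -- The slack `δ` absorbs the error probability, the floors in the message numbers (at most one bit
  -- each, `S.card / N` per channel use) and the additive `1` of the weak converse. There are
  -- finitely many pairs `S`, `k`, so one `N` works for all.
  have hlim : ∀ (S : Finset (Fin M)) (k : Fin K), ∀ᶠ N : ℕ in atTop, ∑ m ∈ S, R m - δ <
      (1 - ((c N).errorProb g k).toReal) * (∑ m ∈ S, R m - S.card * (N : ℝ)⁻¹) -
        (N : ℝ)⁻¹ * (Real.log 2)⁻¹ := fun S k => by
    have h := (((herr' k).const_sub 1).mul ((hinv.const_mul (S.card : ℝ)).const_sub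
      (∑ m ∈ S, R m))).sub (hinv.mul_const (Real.log 2)⁻¹)
    refine h.eventually_const_lt ?_
    simpa using hδ
  obtain ⟨N, hN, hNpos⟩ := ((eventually_all.mpr fun S => eventually_all.mpr (hlim S)).and
    (eventually_gt_atTop 0)).exists
  have hL : ∀ m, 0 < numMessages N (R m) := fun m => numMessages_pos N (hR0 m)
  have := isProbabilityMeasure_jointLaw K N hL
  have hN' : (0 : ℝ) < N := by exact_mod_cast hNpos
  have key : ∀ (S : Finset (Fin M)) (k : Fin K) (D : ℝ), 0 < D →
      (1 - ((c N).errorProb g k).toReal) * ∑ m ∈ S, Real.log (numMessages N (R m)) ≤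
        1 + N * Real.log D → (2 : ℝ) ^ (∑ m ∈ S, R m - δ) ≤ D := fun S k D hD h => by
    have he : 0 ≤ 1 - ((c N).errorProb g k).toReal :=
      sub_nonneg.mpr (ENNReal.toReal_le_of_le_ofReal zero_le_one (by
        rw [ENNReal.ofReal_one]
        exact prob_le_one))
    have hsum : N * Real.log 2 * (∑ m ∈ S, R m - S.card * (N : ℝ)⁻¹) ≤
        ∑ m ∈ S, Real.log (numMessages N (R m)) := by
      refine le_trans (le_of_eq ?_) (Finset.sum_le_sum fun m _ => le_log_numMessages N (hR0 m))
      rw [← Finset.sum_mul, Finset.sum_sub_distrib, ← Finset.mul_sum, Finset.sum_const,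
        nsmul_eq_mul]
      field_simp
    have h1 := (mul_le_mul_of_nonneg_left hsum he).trans h
    rw [← Real.le_logb_iff_rpow_le one_lt_two hD]
    refine (hN S k).le.trans ?_
    rw [Real.logb, le_div_iff₀ hlog]
    refine le_of_mul_le_mul_left ?_ hN'
    calc _ = (1 - ((c N).errorProb g k).toReal) *
          (N * Real.log 2 * (∑ m ∈ S, R m - S.card * (N : ℝ)⁻¹)) - 1 := by
          field_simp
      _ ≤ N * Real.log D := by linarith
  obtain ⟨Q, hQ, hQ1, hS, hk⟩ := (c N).exists_covariance_bounds hL hNpos (hP N)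
  exact ⟨Q, hQ, hQ1,
    -- The decoder of any single receiver yields the cut bounds; this is where a receiver must
    -- exist.
    fun S B hB => key S ⟨0, hK⟩ _ (det_one_add_re_pos hQ B) (hS S _ B hB),
    fun k => key Finset.univ k _
      (add_pos_of_pos_of_nonneg one_pos (re_quadratic_nonneg hQ fun m => g m k)) (hk k)⟩

lemma boundSet_nonempty_of_mem_capacityRegion {M K : ℕ} (hK : 0 < K) {g : Fin M → Fin K → ℂ}
    {R : Fin M → ℝ} (hR : R ∈ capacityRegion g) {δ : ℝ} (hδ : 0 < δ) :
    (boundSet g R δ).Nonempty := by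
  -- At most `M` rates move by this radius each, so a partial sum moves by at most `δ / 2`; the `+
  -- 1` keeps the denominator positive when `M = 0`.
  obtain ⟨R', hR', hd⟩ := Metric.mem_closure_iff.mp hR (δ / (2 * (M + 1))) (by positivity)
  refine (Achievable.boundSet_nonempty hK hR' (half_pos hδ)).mono (boundSet_subset fun S => ?_)
  have h : ∑ m ∈ S, R m - ∑ m ∈ S, R' m ≤ δ / 2 := by
    rw [← Finset.sum_sub_distrib]
    calc ∑ m ∈ S, (R m - R' m) ≤ ∑ m ∈ S, δ / (2 * (M + 1)) :=
          Finset.sum_le_sum fun m _ => (le_abs_self _).trans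
            ((dist_le_pi_dist R R' m).trans hd.le)
      _ = S.card * (δ / (2 * (M + 1))) := by rw [Finset.sum_const, nsmul_eq_mul]
      _ ≤ (M + 1) * (δ / (2 * (M + 1))) := by
          gcongr
          have := (Finset.card_le_univ S).trans_eq (Fintype.card_fin M)
          exact_mod_cast this.trans (Nat.le_succ M)
      _ = δ / 2 := by field_simp
  linarith

/-- The sets for `δ = 1 / (n + 1)` are nested, nonempty and compact, so they share a matrix;
continuity of the powers of `2` then removes `δ` from each of its bounds. -/
lemma boundSet_zero_nonempty {M K : ℕ} (hK : 0 < K) {g : Fin M → Fin K → ℂ}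
    {R : Fin M → ℝ} (hR : R ∈ capacityRegion g) : (boundSet g R 0).Nonempty := by
  have hδ : ∀ n : ℕ, (0 : ℝ) < 1 / ((n : ℝ) + 1) := fun n => Nat.one_div_pos_of_nat
  obtain ⟨Q, hQ⟩ := IsCompact.nonempty_iInter_of_sequence_nonempty_isCompact_isClosed
    (fun n : ℕ => boundSet g R (1 / ((n : ℝ) + 1)))
    (fun n => boundSet_subset fun S => sub_le_sub_left
      (one_div_le_one_div_of_le (by positivity) (by push_cast; linarith)) _)
    (fun n => boundSet_nonempty_of_mem_capacityRegion hK hR (hδ n))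
    (isCompact_boundSet g R _) (fun n => isClosed_boundSet g R _)
  rw [Set.mem_iInter] at hQ
  have hlim : ∀ x D : ℝ, (∀ n : ℕ, (2 : ℝ) ^ (x - 1 / ((n : ℝ) + 1)) ≤ D) →
      (2 : ℝ) ^ (x - 0) ≤ D := fun x D h =>
    le_of_tendsto' ((Real.continuous_const_rpow two_ne_zero).continuousAt.tendsto.comp
      (tendsto_one_div_add_atTop_nhds_zero_nat.const_sub x)) h
  exact ⟨Q, (hQ 0).1, (hQ 0).2.1, fun S B hB => hlim _ _ fun n => (hQ n).2.2.1 S B hB,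
    fun k => hlim _ _ fun n => (hQ n).2.2.2 k⟩

/-- Each cross term is bounded by its modulus, as if all phases were aligned. -/
lemma re_quadratic_le {M K : ℕ} (g : Fin M → Fin K → ℂ) {Q : Matrix (Fin M) (Fin M) ℂ}
    (h1 : ∀ m, Q m m = 1) (k : Fin K) :
    (∑ m, ∑ n, g m k * Q m n * star (g n k)).re ≤
      ∑ m, snr g m k +
        ∑ m, ∑ n ∈ Finset.univ.erase m, ‖Q m n‖ * √(snr g m k * snr g n k) := by
  rw [← Finset.sum_add_distrib, Complex.re_sum]
  refine Finset.sum_le_sum fun m _ => ?_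
  rw [← Finset.add_sum_erase _ _ (Finset.mem_univ m), Complex.add_re, Complex.re_sum]
  refine add_le_add (le_of_eq ?_) (Finset.sum_le_sum fun n _ => (Complex.re_le_norm _).trans
    (le_of_eq ?_))
  · rw [h1, mul_one, RCLike.star_def, Complex.mul_conj, Complex.ofReal_re, snr, Complex.sq_norm]
  · rw [norm_mul, norm_mul, norm_star, snr, snr, ← mul_pow, Real.sqrt_sq (by positivity)]
    ring

end GaussianMulticast

end

theorem theorem4 (M K : ℕ) (hK : 0 < K) (g : Fin M → Fin K → ℂ) :
    GaussianMulticast.capacityRegion g ⊆ GaussianMulticast.outerBoundRegion g := by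
  open GaussianMulticast in
  intro R hR
  obtain ⟨Q, hQ, hQ1, hS, hk⟩ := boundSet_zero_nonempty hK hR
  refine ⟨fun m => ?_, Q, hQ, hQ1, fun S _ => ?_, fun k => ?_⟩
  · have hcl : IsClosed {R : Fin M → ℝ | 0 ≤ R m} :=
      isClosed_le continuous_const (continuous_apply m)
    exact closure_minimal (fun R hR => hR.1 m) hcl hR
  -- Only now, with `Q` fixed, is `B` specialised to the one built from the linear estimate.
  · obtain ⟨B, hB, hBQ⟩ := exists_gain_mul_condCov_eq g hQ.isHermitian S
    have h := hS S B hB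
    rwa [sub_zero, ← Real.le_logb_iff_rpow_le one_lt_two (det_one_add_re_pos hQ B), hBQ] at h
  · have h := hk k
    rw [sub_zero, ← Real.le_logb_iff_rpow_le one_lt_two
      (add_pos_of_pos_of_nonneg one_pos (re_quadratic_nonneg hQ fun m => g m k))] at h
    refine h.trans (Real.logb_le_logb_of_le one_lt_two
      (add_pos_of_pos_of_nonneg one_pos (re_quadratic_nonneg hQ fun m => g m k)) ?_)
    rw [add_assoc]
    exact add_le_add_right (re_quadratic_le g hQ1 k) 1
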